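/- Let $M$ be a compact connected surface (possibly with boundary) with a finite triangulation $\mathcal T=\{V,E,F\}$, i.e. a homeomorphism of $M$ with a finite simplicial complex all of whose simplices are contained in triangles; $V,E,F$ are the sets of vertices, edges $\{ij\}$ and faces $\{ijk\}$. Let $I:E\to(-1,\infty)$, $\{ij\}\mapsto I_{ij}$, be a weight satisfying the structure condition $$I_{ij}+I_{ik}I_{jk}\ge 0,\qquad I_{ik}+I_{ij}I_{jk}\ge 0,\qquad I_{jk}+I_{ij}I_{ik}\ge 0\qquad\text{for every face }\{ijk\}\in F.$$ For $r:V\to(0,\infty)$ define edge lengths $$l_{ij}=\sqrt{r_i^2+r_j^2+2r_ir_jI_{ij}}\quad\text{(Euclidean background geometry)},$$ $$l_{ij}=\cosh^{-1}\bigl(\cosh r_i\cosh r_j+I_{ij}\sinh r_i\sinh r_j\bigr)\quad\text{(hyperbolic background geometry)}.$$ The map $r$ is an inversive distance circle packing metric on $(M,\mathcal T,I)$ in the given background geometry if, for every face $\{ijk\}$, there is a nondegenerate triangle with side lengths $l_{ij},l_{ik},l_{jk}$ in the Euclidean plane, respectively in the hyperbolic plane. Its discrete curvature is the function $K:V\to\mathbb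 R$, $K_i=2\pi-\sum_{\{ijk\}\in F}\theta_i^{jk}$, where $\theta_i^{jk}$ is the inner angle at $i$ of the Euclidean, respectively hyperbolic, triangle with side lengths $l_{ij},l_{ik},l_{jk}$. Then: (1) (Euclidean background geometry) two inversive distance circle packing metrics $r,r'$ on $(M,\mathcal T,I)$ have the same discrete curvature if and only if there is a constant $c>0$ with $r'_i=c\,r_i$ for all $i\in V$; (2) (hyperbolic background geometry) if two inversive distance circle packing metrics $r,r'$ on $(M,\mathcal T,I)$ have the same discrete curvature, then $r=r'$. -/

import Mathlib

namespace CirclePacking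

/-! ### Triangulated surfaces -/

/-- The geometric realization of an abstract simplicial complex on a finite vertex set: the points
of the standard simplex (in barycentric coordinates) whose support is contained in a simplex
of the complex. -/
def realization {V : Type*} [Fintype V] (K : AbstractSimplicialComplex V) : Set (V → ℝ) :=
  {x | x ∈ stdSimplex ℝ V ∧ ∃ s ∈ K, ∀ v, x v ≠ 0 → v ∈ s}

/-- A (finite) triangulation of a topological space `M` by triangles, with vertex set `V`: a
simplicial complex all of whose simplices are triangles or faces of triangles, together with a
homeomorphism of its geometric realization onto `M`. -/
structure Triangulation (V : Type*) [Fintype V] (M : Type*) [TopologicalSpace M] where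
  /-- the vertices, edges and faces -/
  complex : AbstractSimplicialComplex V
  /-- every simplex lies in a triangle -/
  pure : ∀ s ∈ complex, ∃ t ∈ complex, s ⊆ t ∧ t.card = 3
  /-- the space is homeomorphic to the geometric realization -/
  homeo : realization complex ≃ₜ M

namespace Triangulation

variable {V : Type*} [Fintype V] [DecidableEq V] {M : Type*} [TopologicalSpace M]

/-- `{i, j}` is an edge. -/
def IsEdge (T : Triangulation V M) (i j : V) : Prop :=
  i ≠ j ∧ ({i, j} : Finset V) ∈ T.complex

/-- `{i, j, k}` is a (triangular) face. -/
def IsFace (T : Triangulation V M) (i j k : V) : Prop :=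
  i ≠ j ∧ i ≠ k ∧ j ≠ k ∧ ({i, j, k} : Finset V) ∈ T.complex

open Classical in
/-- The cone angle at the vertex `i`: the sum over all faces `{i, j, k}` at `i` of the inner
angle `θ i j k = θ i k j` at `i`. Each face occurs twice in the double sum, as `(j, k)` and as
`(k, j)`, whence the division by `2`. -/
noncomputable def coneAngle (T : Triangulation V M) (θ : V → V → V → ℝ) (i : V) : ℝ :=
  (∑ j, ∑ k, if T.IsFace i j k then θ i j k else 0) / 2

end Triangulation

/-! ### Triangles in the Euclidean and the hyperbolic plane -/

/-- There is a nondegenerate triangle `p q s` in the Euclidean plane whose sides `p q`, `p s`, `q s`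
have lengths `a`, `b`, `c`. -/
def IsEuclideanTriangle (a b c : ℝ) : Prop :=
  ∃ p q s : EuclideanSpace ℝ (Fin 2), AffineIndependent ℝ ![p, q, s] ∧
    dist p q = a ∧ dist p s = b ∧ dist q s = c

/-- Hyperbolic lines (complete geodesics) in the upper half-plane: vertical half-lines and
half-circles centred on the real axis. -/
def IsHyperbolicLine (L : Set UpperHalfPlane) : Prop :=
  (∃ x : ℝ, L = {z : UpperHalfPlane | z.re = x}) ∨
    ∃ x R : ℝ, 0 < R ∧ L = {z : UpperHalfPlane | dist (z : ℂ) (x : ℂ) = R}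

/-- There is a nondegenerate triangle `p q s` in the hyperbolic plane (three points that do not lie
on a common hyperbolic line) whose sides `p q`, `p s`, `q s` have hyperbolic lengths
`a`, `b`, `c`. -/
def IsHyperbolicTriangle (a b c : ℝ) : Prop :=
  ∃ p q s : UpperHalfPlane, (¬ ∃ L, IsHyperbolicLine L ∧ p ∈ L ∧ q ∈ L ∧ s ∈ L) ∧
    dist p q = a ∧ dist p s = b ∧ dist q s = c

/-- The angle of a Euclidean triangle enclosed by the sides of lengths `a` and `b`, the third side
having length `c` (law of cosines). -/
noncomputable def euclideanAngle (a b c : ℝ) : ℝ :=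
  Real.arccos ((a ^ 2 + b ^ 2 - c ^ 2) / (2 * a * b))

/-- The angle of a hyperbolic triangle enclosed by the sides of lengths `a` and `b`, the third side
having length `c` (hyperbolic law of cosines). -/
noncomputable def hyperbolicAngle (a b c : ℝ) : ℝ :=
  Real.arccos ((Real.cosh a * Real.cosh b - Real.cosh c) / (Real.sinh a * Real.sinh b))

/-! ### Inversive distance circle packing metrics

The weight of the edge `{i, j}` is `I s(i, j)`; only its values on edges matter. -/

section Packing

variable {V : Type*}

/-- The length of the edge `{i, j}` in Euclidean background geometry. -/
noncomputable def euclideanLength (I : Sym2 V → ℝ) (r : V → ℝ) (i j : V) : ℝ :=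
  √(r i ^ 2 + r j ^ 2 + 2 * r i * r j * I s(i, j))

/-- The length of the edge `{i, j}` in hyperbolic background geometry. -/
noncomputable def hyperbolicLength (I : Sym2 V → ℝ) (r : V → ℝ) (i j : V) : ℝ :=
  Real.arcosh (Real.cosh (r i) * Real.cosh (r j) + I s(i, j) * Real.sinh (r i) * Real.sinh (r j))

variable [Fintype V] [DecidableEq V] {M : Type*} [TopologicalSpace M]

/-- `r` is an inversive distance circle packing metric in Euclidean background geometry. -/
structure IsEuclideanMetric (T : Triangulation V M) (I : Sym2 V → ℝ) (r : V → ℝ) : Prop where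
  pos : ∀ i, 0 < r i
  nondegenerate : ∀ i j k, T.IsFace i j k →
    IsEuclideanTriangle (euclideanLength I r i j) (euclideanLength I r i k)
      (euclideanLength I r j k)

/-- `r` is an inversive distance circle packing metric in hyperbolic background geometry. -/
structure IsHyperbolicMetric (T : Triangulation V M) (I : Sym2 V → ℝ) (r : V → ℝ) : Prop where
  pos : ∀ i, 0 < r i
  nondegenerate : ∀ i j k, T.IsFace i j k →
    IsHyperbolicTriangle (hyperbolicLength I r i j) (hyperbolicLength I r i k)
      (hyperbolicLength I r j k)

/-- The discrete curvature at `i` in Euclidean background geometry: `2π` less the cone angle. -/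
noncomputable def euclideanCurvature (T : Triangulation V M) (I : Sym2 V → ℝ) (r : V → ℝ)
    (i : V) : ℝ :=
  2 * Real.pi - T.coneAngle (fun i j k => euclideanAngle (euclideanLength I r i j)
    (euclideanLength I r i k) (euclideanLength I r j k)) i

/-- The discrete curvature at `i` in hyperbolic background geometry: `2π` less the cone angle. -/
noncomputable def hyperbolicCurvature (T : Triangulation V M) (I : Sym2 V → ℝ) (r : V → ℝ)
    (i : V) : ℝ :=
  2 * Real.pi - T.coneAngle (fun i j k => hyperbolicAngle (hyperbolicLength I r i j)
    (hyperbolicLength I r i k) (hyperbolicLength I r j k)) i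

end Packing

end CirclePacking

/-! The argument is variational, carried out one triangle at a time. Use as coordinates log r_i in
the Euclidean case and log tanh(r_i / 2) in the hyperbolic case, and let u be the difference of the
coordinates of r' and r. In these coordinates the Jacobian of the three angles of a nondegenerate
triangle is symmetric. It is negative definite in the hyperbolic case; in the Euclidean case it is
negative semidefinite, with only scalings in its kernel. Hence the pairing ∑ u_i θ_i has negative
derivative along the segment from r to r', unless u is zero (respectively constant) on the triangle.

Definiteness (`euclideanForm_pos`, `hyperbolicForm_pos`) rests on two consequences of the structure
condition. At least two of the three edge coefficients are positive (`cofactorForm_two_pos`), and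
the relevant determinant is a positive multiple of the polynomial in `structure_poly_pos`.

The segment may leave the set of nondegenerate triangles. Since `Real.arccos` is constant outside
[-1, 1], the angles extend continuously, and a degenerate triangle has angles π, 0, 0. There the
pairing takes only the values u_i π, a finite set, and a continuous function that has negative
derivative off a finite set of values cannot increase (`le_of_deriv_neg_off_finite`). This gives
`euclideanPairing_lt` and `hyperbolicPairing_lt`.

Summing over faces turns the pairings into ∑ u_i (cone angle at i), which is the same for r and r'
when the curvatures agree. So no face can have a strict decrease: u vanishes on every face in the
hyperbolic case, and is constant on every face, hence on the connected surface, in the Euclidean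
case. -/

namespace CirclePacking

/-! ### Monotonicity in the presence of an exceptional finite set of values -/

/-- A continuous function on `[a, b]` that has a negative derivative wherever its value lies outside
a fixed finite set is nonincreasing. -/
lemma le_of_deriv_neg_off_finite {g : ℝ → ℝ} {Φ : Set ℝ} (hΦ : Φ.Finite) {a b : ℝ} (hab : a ≤ b)
    (hc : ContinuousOn g (Set.Icc a b))
    (hd : ∀ t ∈ Set.Icc a b, g t ∈ Φ ∨ ∃ d < 0, HasDerivAt g d t) : g b ≤ g a := by
  by_contra! hlt
  -- An increase would cross some level y outside the finite set. At the last time t with g t ≤ y,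
  -- the value is y, so the derivative is negative, although g > y from then on.
  obtain ⟨y, hy, hyΦ⟩ : ∃ y ∈ Set.Ioo (g a) (g b), y ∉ Φ := by
    by_contra! h
    exact (Set.Ioo_infinite hlt) (hΦ.subset h)
  set S : Set ℝ := Set.Icc a b ∩ g ⁻¹' Set.Iic y with hS
  have hSc : IsCompact S := by
    have : IsClosed S := hc.preimage_isClosed_of_isClosed isClosed_Icc isClosed_Iic
    exact isCompact_Icc.of_isClosed_subset this Set.inter_subset_left
  have hSne : S.Nonempty := ⟨a, ⟨le_rfl, hab⟩, hy.1.le⟩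
  obtain ⟨t, htS, htmax⟩ := hSc.exists_isGreatest hSne
  have htb : t < b := by
    rcases htS.1.2.lt_or_eq with h | h
    · exact h
    · have := htS.2
      rw [h] at this
      exact absurd this (not_le.2 hy.2)
  have hafter : ∀ s ∈ Set.Ioc t b, y < g s := by
    intro s hs
    by_contra! h
    exact absurd (htmax ⟨⟨htS.1.1.trans hs.1.le, hs.2⟩, h⟩) (not_le.2 hs.1)
  have hty : g t = y := by
    refine le_antisymm htS.2 ?_
    by_contra! h
    obtain ⟨s, hs, hsy⟩ := intermediate_value_Icc htb.le
      (hc.mono (Set.Icc_subset_Icc htS.1.1 le_rfl)) (show y ∈ Set.Icc (g t) (g b) from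
        ⟨h.le, hy.2.le⟩)
    have hst : t ≠ s := by
      rintro rfl
      exact h.ne hsy
    exact (hafter s ⟨lt_of_le_of_ne hs.1 hst, hs.2⟩).ne' hsy
  rcases hd t htS.1 with h | ⟨d, hd0, hdt⟩
  · exact hyΦ (hty ▸ h)
  · have h1 := (hasDerivAt_iff_tendsto_slope.1 hdt).eventually (gt_mem_nhds hd0)
    have h2 : ∀ᶠ s in nhdsWithin t (Set.Ioi t), slope g t s < 0 :=
      h1.filter_mono (nhdsWithin_mono _ fun s hs => (ne_of_gt hs : s ≠ t))
    have h3 : ∀ᶠ s in nhdsWithin t (Set.Ioi t), s ∈ Set.Ioc t b :=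
      Ioc_mem_nhdsGT htb
    obtain ⟨s, hs, hs'⟩ := (h2.and h3).exists
    have hgt := hafter s hs'
    rw [slope_def_field, div_neg_iff] at hs
    have := hs'.1
    rcases hs with h | h <;> linarith [h.1, h.2]

/-- If moreover the derivative is negative at the left end, the function is smaller at the right
end. -/
lemma lt_of_deriv_neg_off_finite {g : ℝ → ℝ} {Φ : Set ℝ} (hΦ : Φ.Finite) {a b : ℝ} (hab : a < b)
    (hc : ContinuousOn g (Set.Icc a b))
    (hd : ∀ t ∈ Set.Icc a b, g t ∈ Φ ∨ ∃ d < 0, HasDerivAt g d t)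
    (ha : ∃ d < 0, HasDerivAt g d a) : g b < g a := by
  obtain ⟨d, hd0, hdt⟩ := ha
  have h1 := (hasDerivAt_iff_tendsto_slope.1 hdt).eventually (gt_mem_nhds hd0)
  have h2 : ∀ᶠ s in nhdsWithin a (Set.Ioi a), slope g a s < 0 :=
    h1.filter_mono (nhdsWithin_mono _ fun s hs => (ne_of_gt hs : s ≠ a))
  have h3 : ∀ᶠ s in nhdsWithin a (Set.Ioi a), s ∈ Set.Ioc a b := Ioc_mem_nhdsGT hab
  -- g drops strictly from a to some s close by, and does not increase on [s, b].
  obtain ⟨s, hs, hs'⟩ := (h2.and h3).exists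
  have hsub : Set.Icc s b ⊆ Set.Icc a b := Set.Icc_subset_Icc hs'.1.le le_rfl
  have hle := le_of_deriv_neg_off_finite hΦ hs'.2 (hc.mono hsub) fun t ht => hd t (hsub ht)
  rw [slope_def_field, div_neg_iff] at hs
  have := hs'.1
  rcases hs with h | h <;> linarith [h.1, h.2]

/-! ### The derivative of an angle given by its cosine `n / √p` -/

/-- With the cosine in the form n / √p, the square root in the denominator is that of p - n². For
the angles of a triangle this is `heron` or `gramDet`, symmetric in the sides, so the three angle
derivatives share one positive factor. -/
lemma hasDerivAt_arccos_div_sqrt {n p : ℝ → ℝ} {n' p' t : ℝ} (hn : HasDerivAt n n' t)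
    (hp : HasDerivAt p p' t) (hp0 : 0 < p t) (hΔ : 0 < p t - n t ^ 2) :
    HasDerivAt (fun t => Real.arccos (n t / √(p t)))
      ((n t * p' / (2 * p t) - n') / √(p t - n t ^ 2)) t := by
  have hs : 0 < √(p t) := Real.sqrt_pos.2 hp0
  have hs2 : √(p t) ^ 2 = p t := Real.sq_sqrt hp0.le
  have hlt : (n t / √(p t)) ^ 2 < 1 := by
    rw [div_pow, hs2, div_lt_one hp0]
    linarith
  have habs := abs_lt.1 ((sq_lt_one_iff_abs_lt_one _).1 hlt)
  have h := (Real.hasDerivAt_arccos habs.1.ne' habs.2.ne).comp t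
    (hn.div (hp.sqrt hp0.ne') hs.ne')
  refine h.congr_deriv ?_
  have e : √(1 - (n t / √(p t)) ^ 2) = √(p t - n t ^ 2) / √(p t) := by
    rw [← Real.sqrt_div' _ hp0.le, div_pow, hs2]
    congr 1
    field_simp
  rw [e]
  have hd : 0 < √(p t - n t ^ 2) := Real.sqrt_pos.2 hΔ
  generalize √(p t - n t ^ 2) = δ at *
  rw [hs2]
  field_simp
  rw [hs2]
  ring

/-! ### Quadratic forms attached to a weighted triangle -/

/-- The third component of the adjugate of the matrix with diagonal entries `1` and off-diagonal
entries `-a`, `-b`, `-c`, applied to the vector `(x, y, z)`. -/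
def cofactorForm (a b c x y z : ℝ) : ℝ :=
  (1 - c ^ 2) * z + (b + a * c) * x + (a + b * c) * y

lemma cofactorForm_swap (a b c x y z : ℝ) :
    cofactorForm b a c y x z = cofactorForm a b c x y z := by
  unfold cofactorForm; ring

/-- The determinant of the matrix with diagonal entries `1` and off-diagonal entries `-a`, `-b`,
`-c`. -/
def weightDet (a b c : ℝ) : ℝ := 1 - 2 * a * b * c - a ^ 2 - b ^ 2 - c ^ 2

/-- Under the structure condition at most one of the three cofactor forms is nonpositive. -/
lemma cofactorForm_pos_or {a b c x y z : ℝ} (ha : -1 < a) (hb : -1 < b)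
    (hx : 0 < x) (hy : 0 < y) (hz : 0 < z)
    (h1 : 0 ≤ a + b * c) (h2 : 0 ≤ b + a * c) (h3 : 0 ≤ c + a * b)
    (hpos : cofactorForm b c a y z x ≤ 0 → cofactorForm a c b x z y ≤ 0 →
      0 < cofactorForm a b c x y z) :
    0 < cofactorForm b c a y z x ∨ 0 < cofactorForm a c b x z y := by
  by_contra! h
  obtain ⟨hh1, hh2⟩ := h
  have hh3 := hpos hh1 hh2
  set f := cofactorForm b c a y z x with hf
  set g := cofactorForm a c b x z y with hg
  set k := cofactorForm a b c x y z with hk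
  have ef : f = (1 - a ^ 2) * x + (c + a * b) * y + (b + a * c) * z := by
    rw [hf, cofactorForm]; ring
  have eg : g = (1 - b ^ 2) * y + (c + a * b) * x + (a + b * c) * z := by
    rw [hg, cofactorForm]; ring
  have p1 : 0 ≤ (c + a * b) * y := by positivity
  have p2 : 0 ≤ (b + a * c) * z := by positivity
  have p3 : 0 ≤ (c + a * b) * x := by positivity
  have p4 : 0 ≤ (a + b * c) * z := by positivity
  -- The off-diagonal terms of f and g are nonnegative by the structure condition, so f, g ≤ 0 force
  -- 1 - a² and 1 - b² to be nonpositive.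
  have ha1 : 1 ≤ a := by
    by_contra! hlt
    have : 0 < (1 - a ^ 2) * x := mul_pos (by nlinarith) hx
    linarith
  have hb1 : 1 ≤ b := by
    by_contra! hlt
    have : 0 < (1 - b ^ 2) * y := mul_pos (by nlinarith) hy
    linarith
  -- Multiply the inequalities f ≤ 0 and g ≤ 0; note (a² - 1)(b² - 1) - (c + ab)² = `weightDet a b
  -- c`.
  have hdet : 0 ≤ weightDet a b c := by
    have q1 : (c + a * b) * y ≤ (a ^ 2 - 1) * x := by linarith
    have q2 : (c + a * b) * x ≤ (b ^ 2 - 1) * y := by linarith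
    have q3 := mul_le_mul q1 q2 p3 (p1.trans q1)
    have q4 : 0 ≤ ((a ^ 2 - 1) * (b ^ 2 - 1) - (c + a * b) ^ 2) * (x * y) := by linarith
    have q5 := nonneg_of_mul_nonneg_left q4 (mul_pos hx hy)
    unfold weightDet; linarith
  -- A matrix times its adjugate is its determinant. With b k > 0 and f, g ≤ 0 this forces c > 0,
  -- and then a, b ≥ 1 make the determinant negative.
  have r1 : f - c * g - b * k = weightDet a b c * x := by
    rw [hf, hg, hk]; unfold cofactorForm weightDet; ring
  have r2 : g - c * f - a * k = weightDet a b c * y := by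
    rw [hf, hg, hk]; unfold cofactorForm weightDet; ring
  have s1 : 0 ≤ weightDet a b c * x := by positivity
  have hbk : 0 < b * k := by positivity
  have hc : 0 < c := by
    by_contra! hc
    nlinarith [mul_nonneg_of_nonpos_of_nonpos hc hh2]
  unfold weightDet at hdet
  have : 0 < a * b * c := by positivity
  nlinarith

/-- Under the structure condition, if one of the three cofactor forms is positive, two are. -/
lemma cofactorForm_two_pos {a b c x y z : ℝ} (ha : -1 < a) (hb : -1 < b) (hc : -1 < c)
    (hx : 0 < x) (hy : 0 < y) (hz : 0 < z)
    (h1 : 0 ≤ a + b * c) (h2 : 0 ≤ b + a * c) (h3 : 0 ≤ c + a * b)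
    (hpos : 0 < cofactorForm b c a y z x ∨ 0 < cofactorForm a c b x z y ∨
      0 < cofactorForm a b c x y z) :
    (0 < cofactorForm b c a y z x ∧ 0 < cofactorForm a c b x z y) ∨
    (0 < cofactorForm b c a y z x ∧ 0 < cofactorForm a b c x y z) ∨
    (0 < cofactorForm a c b x z y ∧ 0 < cofactorForm a b c x y z) := by
  have d12 := cofactorForm_pos_or ha hb hx hy hz h1 h2 h3
  have d13 := cofactorForm_pos_or ha hc hx hz hy (by linarith) h3 h2
  have d23 := cofactorForm_pos_or (a := b) (b := c) (c := a) hb hc hy hz hx (by linarith) (by linarith) (by linarith)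
  rw [cofactorForm_swap b c a y z x] at d13
  rw [cofactorForm_swap a c b x z y, cofactorForm_swap a b c x y z] at d23
  simp only [← not_lt] at d12 d13 d23
  tauto

/-- Positivity from the structure condition: this polynomial is at least
`2 (1 + a) (1 + b) (1 + c) x y z`. -/
lemma structure_poly_pos {a b c x y z : ℝ} (ha : -1 < a) (hb : -1 < b) (hc : -1 < c)
    (hx : 0 < x) (hy : 0 < y) (hz : 0 < z)
    (h1 : 0 ≤ a + b * c) (h2 : 0 ≤ b + a * c) (h3 : 0 ≤ c + a * b) :
    0 < 2 * (1 + a * b * c) * (x * y * z) + (a + b * c) * (x * (y ^ 2 + z ^ 2)) +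
      (b + a * c) * (y * (x ^ 2 + z ^ 2)) + (c + a * b) * (z * (x ^ 2 + y ^ 2)) := by
  have e : 2 * (1 + a * b * c) * (x * y * z) + (a + b * c) * (x * (y ^ 2 + z ^ 2)) +
      (b + a * c) * (y * (x ^ 2 + z ^ 2)) + (c + a * b) * (z * (x ^ 2 + y ^ 2)) =
      2 * ((1 + a) * (1 + b) * (1 + c)) * (x * y * z) + ((a + b * c) * (x * (y - z) ^ 2) +
      (b + a * c) * (y * (x - z) ^ 2) + (c + a * b) * (z * (x - y) ^ 2)) := by ring
  rw [e]
  have : 0 < (1 + a) * (1 + b) * (1 + c) :=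
    mul_pos (mul_pos (by linarith) (by linarith)) (by linarith)
  positivity

/-! ### The Euclidean quadratic form -/

/-- The third coefficient may be negative: multiplying the form by w₁ + w₂ and completing the square
leaves the pairwise-product sum times (x - y)². -/
lemma quadraticForm_two_pos {w₁ w₂ w₃ : ℝ} (h1 : 0 < w₁) (h2 : 0 < w₂)
    (hdet : 0 < w₁ * w₂ + w₁ * w₃ + w₂ * w₃) {x y : ℝ} (hxy : x ≠ 0 ∨ y ≠ 0) :
    0 < w₁ * x ^ 2 + w₂ * y ^ 2 + w₃ * (x - y) ^ 2 := by
  by_cases h : x = y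
  · subst h
    have hx : x ≠ 0 := by tauto
    have : 0 < x ^ 2 := by positivity
    have := mul_pos h1 this
    have := mul_pos h2 ‹0 < x ^ 2›
    simp only [sub_self]
    linarith
  · have hs : 0 < (x - y) ^ 2 := by
      have := sub_ne_zero.2 h
      positivity
    have key : (w₁ + w₂) * (w₁ * x ^ 2 + w₂ * y ^ 2 + w₃ * (x - y) ^ 2) =
        (w₁ * x + w₂ * y) ^ 2 + (w₁ * w₂ + w₁ * w₃ + w₂ * w₃) * (x - y) ^ 2 := by ring
    have hp : 0 < (w₁ * x + w₂ * y) ^ 2 + (w₁ * w₂ + w₁ * w₃ + w₂ * w₃) * (x - y) ^ 2 :=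
      add_pos_of_nonneg_of_pos (sq_nonneg _) (mul_pos hdet hs)
    rw [← key] at hp
    exact pos_of_mul_pos_right hp (by linarith)

/-- The square of the side length joining two circles of radii `x`, `y`. -/
def sqLength (c x y : ℝ) : ℝ := x ^ 2 + y ^ 2 + 2 * x * y * c

lemma sqLength_pos {c x y : ℝ} (hc : -1 < c) (hx : 0 < x) (hy : 0 < y) : 0 < sqLength c x y := by
  have : 0 < 2 * x * y * (1 + c) := by
    have : 0 < 1 + c := by linarith
    positivity
  unfold sqLength
  nlinarith [sq_nonneg (x - y)]

lemma sqLength_comm (c x y : ℝ) : sqLength c x y = sqLength c y x := by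
  unfold sqLength; ring

/-- The radius version of `cofactorForm`. -/
def radiusForm (a b c x y z : ℝ) : ℝ := cofactorForm a b c (y * z) (x * z) (x * y)

/-- The logarithmic derivative of `sqLength`. -/
def sqLengthDeriv (c x y u v : ℝ) : ℝ := 2 * (x ^ 2 * u + y ^ 2 * v + x * y * c * (u + v))

/-- Sixteen times the square of the area of the triangle whose squared side lengths are given. -/
def heron (A B C : ℝ) : ℝ := 4 * A * B - (A + B - C) ^ 2

/-- The derivative of the Euclidean angle enclosed by the first two sides, up to the positive factor
`√(heron A B C)`. -/
noncomputable def angleDeriv (A B C A' B' C' : ℝ) : ℝ :=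
  (A + B - C) * (A' / A + B' / B) / 2 - (A' + B' - C')

/-- As the coefficients are positive, a nondegenerate triangle has at least one positive
`radiusForm`. -/
lemma heron_sqLength (a b c x y z : ℝ) :
    heron (sqLength c x y) (sqLength b x z) (sqLength a y z) =
      4 * (y * z * radiusForm b c a y z x + x * z * radiusForm a c b x z y +
        x * y * radiusForm a b c x y z) := by
  unfold heron sqLength radiusForm cofactorForm; ring

/-- The coefficient of u - v is unchanged when the two circles are exchanged (`radiusForm_swap`),
which is the symmetry of the Jacobian. Only differences occur because scaling preserves angles. -/
lemma angleDeriv_sqLength {a b c x y z : ℝ} (hA : sqLength c x y ≠ 0) (hB : sqLength b x z ≠ 0)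
    (u v w : ℝ) :
    angleDeriv (sqLength c x y) (sqLength b x z) (sqLength a y z)
      (sqLengthDeriv c x y u v) (sqLengthDeriv b x z u w) (sqLengthDeriv a y z v w) =
      - (2 * x * y * radiusForm a b c x y z / sqLength c x y * (u - v) +
        2 * x * z * radiusForm a c b x z y / sqLength b x z * (u - w)) := by
  unfold angleDeriv
  field_simp
  unfold sqLength sqLengthDeriv radiusForm cofactorForm
  ring

lemma radiusForm_swap (a b c x y z : ℝ) : radiusForm b a c y x z = radiusForm a b c x y z := by
  unfold radiusForm cofactorForm; ring

/-- Up to positive factors the left side is the sum of pairwise products of the three edge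
coefficients, with denominators cleared. It factors as `heron` / 4 times the structure polynomial.
-/
lemma radiusForm_det (a b c x y z : ℝ) :
    z * radiusForm b c a y z x * radiusForm a c b x z y * sqLength c x y +
      y * radiusForm b c a y z x * radiusForm a b c x y z * sqLength b x z +
      x * radiusForm a c b x z y * radiusForm a b c x y z * sqLength a y z =
    (y * z * radiusForm b c a y z x + x * z * radiusForm a c b x z y +
        x * y * radiusForm a b c x y z) *
      (2 * (1 + a * b * c) * (x * y * z) + (a + b * c) * (x * (y ^ 2 + z ^ 2)) +
      (b + a * c) * (y * (x ^ 2 + z ^ 2)) + (c + a * b) * (z * (x ^ 2 + y ^ 2))) := by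
  unfold sqLength radiusForm cofactorForm; ring

/-- Positivity of the Euclidean form when two of its coefficients are positive. -/
lemma euclideanForm_pos_of_two_pos {a b c x y z : ℝ} (ha : -1 < a) (hb : -1 < b) (hc : -1 < c)
    (hx : 0 < x) (hy : 0 < y) (hz : 0 < z)
    (h1 : 0 ≤ a + b * c) (h2 : 0 ≤ b + a * c) (h3 : 0 ≤ c + a * b)
    (hH : 0 < heron (sqLength c x y) (sqLength b x z) (sqLength a y z))
    (p1 : 0 < radiusForm b c a y z x) (p2 : 0 < radiusForm a c b x z y)
    {u v w : ℝ} (hne : ¬ (u = w ∧ v = w)) :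
    0 < 2 * x * y * radiusForm a b c x y z / sqLength c x y * (u - v) ^ 2 +
      2 * x * z * radiusForm a c b x z y / sqLength b x z * (u - w) ^ 2 +
      2 * y * z * radiusForm b c a y z x / sqLength a y z * (v - w) ^ 2 := by
  have l1 := sqLength_pos ha hy hz
  have l2 := sqLength_pos hb hx hz
  have l3 := sqLength_pos hc hx hy
  have hdet := radiusForm_det a b c x y z
  have hT := structure_poly_pos ha hb hc hx hy hz h1 h2 h3
  rw [heron_sqLength] at hH
  have hG := pos_of_mul_pos_right hH (by norm_num)
  have hpos := mul_pos hG hT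
  rw [← hdet] at hpos
  set R1 := radiusForm b c a y z x
  set R2 := radiusForm a c b x z y
  set R3 := radiusForm a b c x y z
  set L1 := sqLength a y z
  set L2 := sqLength b x z
  set L3 := sqLength c x y
  have hne' : u - w ≠ 0 ∨ v - w ≠ 0 := by
    by_contra! h
    exact hne ⟨sub_eq_zero.1 h.1, sub_eq_zero.1 h.2⟩
  have w1 : 0 < 2 * y * z * R1 / L1 := by positivity
  have w2 : 0 < 2 * x * z * R2 / L2 := by positivity
  have hd : 0 < 2 * x * z * R2 / L2 * (2 * y * z * R1 / L1) +
      2 * x * z * R2 / L2 * (2 * x * y * R3 / L3) +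
      2 * y * z * R1 / L1 * (2 * x * y * R3 / L3) := by
    have e : 2 * x * z * R2 / L2 * (2 * y * z * R1 / L1) +
      2 * x * z * R2 / L2 * (2 * x * y * R3 / L3) +
      2 * y * z * R1 / L1 * (2 * x * y * R3 / L3) =
      4 * (x * y * z) * (z * R1 * R2 * L3 + y * R1 * R3 * L2 + x * R2 * R3 * L1) /
        (L1 * L2 * L3) := by
      field_simp
      ring
    rw [e]
    positivity
  have := quadraticForm_two_pos w2 w1 hd hne'
  have e : u - w - (v - w) = u - v := by ring
  rw [e] at this
  linarith

lemma heron_swap (A B C : ℝ) : heron B A C = heron A B C := by unfold heron; ring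

lemma sqLengthDeriv_comm (c x y u v : ℝ) : sqLengthDeriv c x y u v = sqLengthDeriv c y x v u := by
  unfold sqLengthDeriv; ring

/-- The form is invariant under relabelling the circles, so whichever two coefficients are positive,
they can be moved into the position required by `euclideanForm_pos_of_two_pos`. -/
lemma euclideanForm_pos {a b c x y z : ℝ} (ha : -1 < a) (hb : -1 < b) (hc : -1 < c)
    (hx : 0 < x) (hy : 0 < y) (hz : 0 < z)
    (h1 : 0 ≤ a + b * c) (h2 : 0 ≤ b + a * c) (h3 : 0 ≤ c + a * b)
    (hH : 0 < heron (sqLength c x y) (sqLength b x z) (sqLength a y z))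
    {u v w : ℝ} (hne : ¬ (u = w ∧ v = w)) :
    0 < 2 * x * y * radiusForm a b c x y z / sqLength c x y * (u - v) ^ 2 +
      2 * x * z * radiusForm a c b x z y / sqLength b x z * (u - w) ^ 2 +
      2 * y * z * radiusForm b c a y z x / sqLength a y z * (v - w) ^ 2 := by
  have s1 : radiusForm c b a z y x = radiusForm b c a y z x := radiusForm_swap ..
  have s2 : radiusForm c a b z x y = radiusForm a c b x z y := radiusForm_swap ..
  have s3 : radiusForm b a c y x z = radiusForm a b c x y z := radiusForm_swap ..
  have hG := hH
  rw [heron_sqLength] at hG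
  have h13 : heron (sqLength b x z) (sqLength c x y) (sqLength a z y) =
      heron (sqLength c x y) (sqLength b x z) (sqLength a y z) := by
    rw [heron_swap, sqLength_comm a]
  have h23 : heron (sqLength a z y) (sqLength b z x) (sqLength c y x) =
      heron (sqLength c x y) (sqLength b x z) (sqLength a y z) := by
    rw [sqLength_comm a z y, sqLength_comm b z x, sqLength_comm c y x]
    unfold heron; ring
  have two := cofactorForm_two_pos (x := y * z) (y := x * z) (z := x * y) ha hb hc
    (by positivity) (by positivity) (by positivity) h1 h2 h3 (by
      by_contra! hn
      obtain ⟨n1, n2, n3⟩ := hn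
      unfold radiusForm at hG
      simp only [mul_comm z x, mul_comm y x, mul_comm z y] at hG
      have q1 := mul_nonpos_of_nonneg_of_nonpos (mul_pos hy hz).le n1
      have q2 := mul_nonpos_of_nonneg_of_nonpos (mul_pos hx hz).le n2
      have q3 := mul_nonpos_of_nonneg_of_nonpos (mul_pos hx hy).le n3
      linarith)
  have r1 : cofactorForm b c a (x * z) (x * y) (y * z) = radiusForm b c a y z x := by
    unfold radiusForm; ring_nf
  have r2 : cofactorForm a c b (y * z) (x * y) (x * z) = radiusForm a c b x z y := by
    unfold radiusForm; ring_nf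
  have r3 : cofactorForm a b c (y * z) (x * z) (x * y) = radiusForm a b c x y z := rfl
  rw [r1, r2, r3] at two
  rcases two with ⟨p, q⟩ | ⟨p, q⟩ | ⟨p, q⟩
  · exact euclideanForm_pos_of_two_pos ha hb hc hx hy hz h1 h2 h3 hH p q hne
  · have := euclideanForm_pos_of_two_pos (u := u) (v := w) (w := v) ha hc hb hx hz hy
      (by linarith) h3 h2 (h13 ▸ hH) (s1 ▸ p) q (by grind)
    rw [s1, sqLength_comm a z y] at this
    linarith [this, show (w - v) ^ 2 = (v - w) ^ 2 by ring,
      show 2 * z * y * radiusForm b c a y z x / sqLength a y z * (w - v) ^ 2 =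
        2 * y * z * radiusForm b c a y z x / sqLength a y z * (v - w) ^ 2 by ring]
  · have := euclideanForm_pos_of_two_pos (u := w) (v := v) (w := u) hc hb ha hz hy hx
      (by linarith) (by linarith) (by linarith) (h23 ▸ hH) (s3 ▸ q) (s2 ▸ p) (by grind)
    rw [s1, s2, s3, sqLength_comm a z y, sqLength_comm b z x, sqLength_comm c y x] at this
    linarith [this,
      show 2 * z * y * radiusForm b c a y z x / sqLength a y z * (w - v) ^ 2 =
        2 * y * z * radiusForm b c a y z x / sqLength a y z * (v - w) ^ 2 by ring,
      show 2 * z * x * radiusForm a c b x z y / sqLength b x z * (w - u) ^ 2 =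
        2 * x * z * radiusForm a c b x z y / sqLength b x z * (u - w) ^ 2 by ring,
      show 2 * y * x * radiusForm a b c x y z / sqLength c x y * (v - u) ^ 2 =
        2 * x * y * radiusForm a b c x y z / sqLength c x y * (u - v) ^ 2 by ring]

/-- The derivative of the pairing of the Euclidean angles with the direction of motion is negative,
up to the positive factor `√(heron A B C)`. -/
lemma sum_angleDeriv_neg {a b c x y z : ℝ} (ha : -1 < a) (hb : -1 < b) (hc : -1 < c)
    (hx : 0 < x) (hy : 0 < y) (hz : 0 < z)
    (h1 : 0 ≤ a + b * c) (h2 : 0 ≤ b + a * c) (h3 : 0 ≤ c + a * b)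
    (hH : 0 < heron (sqLength c x y) (sqLength b x z) (sqLength a y z))
    {u v w : ℝ} (hne : ¬ (u = w ∧ v = w)) :
    u * angleDeriv (sqLength c x y) (sqLength b x z) (sqLength a y z)
        (sqLengthDeriv c x y u v) (sqLengthDeriv b x z u w) (sqLengthDeriv a y z v w) +
      v * angleDeriv (sqLength c x y) (sqLength a y z) (sqLength b x z)
        (sqLengthDeriv c x y u v) (sqLengthDeriv a y z v w) (sqLengthDeriv b x z u w) +
      w * angleDeriv (sqLength b x z) (sqLength a y z) (sqLength c x y)
        (sqLengthDeriv b x z u w) (sqLengthDeriv a y z v w) (sqLengthDeriv c x y u v) < 0 := by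
  have l1 := (sqLength_pos ha hy hz).ne'
  have l2 := (sqLength_pos hb hx hz).ne'
  have l3 := (sqLength_pos hc hx hy).ne'
  have e1 := angleDeriv_sqLength (a := a) l3 l2 u v w
  have e2 := angleDeriv_sqLength (a := b) (b := a) (c := c) (x := y) (y := x) (z := z)
    (sqLength_comm c x y ▸ l3) l1 v u w
  have e3 := angleDeriv_sqLength (a := c) (b := a) (c := b) (x := z) (y := x) (z := y)
    (sqLength_comm b x z ▸ l2) (sqLength_comm a y z ▸ l1) w u v
  have s1 : radiusForm c b a z y x = radiusForm b c a y z x := radiusForm_swap ..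
  have s2 : radiusForm c a b z x y = radiusForm a c b x z y := radiusForm_swap ..
  have s3 : radiusForm b a c y x z = radiusForm a b c x y z := radiusForm_swap ..
  rw [sqLength_comm c y x, sqLengthDeriv_comm c y x, s3] at e2
  rw [sqLength_comm b z x, sqLengthDeriv_comm b z x, sqLength_comm a z y,
    sqLengthDeriv_comm a z y, s2, s1] at e3
  rw [e1, e2, e3]
  have := euclideanForm_pos ha hb hc hx hy hz h1 h2 h3 hH hne
  linear_combination this

/-! ### The hyperbolic quadratic form

The radii enter through numbers `x`, `y`, `z` (their hyperbolic cotangents) and `p`, `q`, `r` (the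
inverses of their hyperbolic sines), with `p ^ 2 = x ^ 2 - 1` and so on. -/

/-- The hyperbolic cosine of the side length joining two circles. -/
noncomputable def coshLength (c x y p q : ℝ) : ℝ := (x * y + c) / (p * q)

/-- The derivative of `coshLength`. -/
noncomputable def coshLengthDeriv (c x y p q u v : ℝ) : ℝ :=
  u * ((y + c * x) / (p ^ 2 * q)) + v * ((x + c * y) / (q ^ 2 * p))

/-- `coshLength c x y p q ^ 2 - 1` up to the factor `(p * q) ^ 2`. -/
def edgeForm (c x y : ℝ) : ℝ := x ^ 2 + y ^ 2 + 2 * c * x * y + c ^ 2 - 1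

/-- The coefficient of an edge in the hyperbolic quadratic form. -/
noncomputable def edgeWeight (a b c x y z r : ℝ) : ℝ :=
  cofactorForm a b c x y z / (r * edgeForm c x y)

/-- The determinant of the symmetric matrix with diagonal entries `1` and off-diagonal entries `A`,
`B`, `C`. -/
def gramDet (A B C : ℝ) : ℝ := 1 + 2 * A * B * C - A ^ 2 - B ^ 2 - C ^ 2

/-- The derivative of the hyperbolic angle enclosed by the first two sides, up to the positive
factor `√(gramDet A B C)`; sides are given by their hyperbolic cosines. -/
noncomputable def hypAngleDeriv (A B C A' B' C' : ℝ) : ℝ :=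
  C' + A' * ((B - A * C) / (A ^ 2 - 1)) + B' * ((A - B * C) / (B ^ 2 - 1))

lemma coshLength_comm (c x y p q : ℝ) : coshLength c x y p q = coshLength c y x q p := by
  unfold coshLength; ring

lemma coshLengthDeriv_comm (c x y p q u v : ℝ) :
    coshLengthDeriv c x y p q u v = coshLengthDeriv c y x q p v u := by
  unfold coshLengthDeriv; ring

lemma edgeForm_comm (c x y : ℝ) : edgeForm c x y = edgeForm c y x := by
  unfold edgeForm; ring

lemma edgeWeight_swap (a b c x y z r : ℝ) :
    edgeWeight b a c y x z r = edgeWeight a b c x y z r := by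
  unfold edgeWeight; rw [cofactorForm_swap, edgeForm_comm]

lemma coshLength_sq_sub_one {c x y p q : ℝ} (hp0 : p ≠ 0) (hq0 : q ≠ 0) (hp : p ^ 2 = x ^ 2 - 1)
    (hq : q ^ 2 = y ^ 2 - 1) : coshLength c x y p q ^ 2 - 1 = edgeForm c x y / (p ^ 2 * q ^ 2) := by
  have : coshLength c x y p q ^ 2 - 1 = ((x * y + c) ^ 2 - p ^ 2 * q ^ 2) / (p ^ 2 * q ^ 2) := by
    unfold coshLength; field_simp
  rw [this]
  congr 1
  rw [hp, hq]; unfold edgeForm; ring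

lemma one_lt_coshLength {c x y p q : ℝ} (hc : -1 < c) (hx : 0 < x) (hy : 0 < y) (hp0 : 0 < p)
    (hq0 : 0 < q) (hp : p ^ 2 = x ^ 2 - 1) (hq : q ^ 2 = y ^ 2 - 1) :
    1 < coshLength c x y p q := by
  unfold coshLength
  rw [one_lt_div (by positivity)]
  -- With x = cosh X, p = sinh X and so on, this is cosh (X - Y) ≥ 1.
  have h : p * q + 1 ≤ x * y := by
    refine abs_le_of_sq_le_sq' ?_ (by positivity) |>.2
    nlinarith [sq_nonneg (p - q)]
  linarith

lemma edgeForm_pos {c x y p q : ℝ} (hc : -1 < c) (hx : 0 < x) (hy : 0 < y) (hp0 : 0 < p)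
    (hq0 : 0 < q) (hp : p ^ 2 = x ^ 2 - 1) (hq : q ^ 2 = y ^ 2 - 1) : 0 < edgeForm c x y := by
  have h := one_lt_coshLength hc hx hy hp0 hq0 hp hq
  have e := coshLength_sq_sub_one (c := c) hp0.ne' hq0.ne' hp hq
  have : 0 < edgeForm c x y / (p ^ 2 * q ^ 2) := by rw [← e]; nlinarith
  exact pos_of_mul_pos_left this (by positivity)

section Identities

variable {a b c x y z p q r : ℝ}

lemma coshLength_sub_mul (hp0 : p ≠ 0) (hq0 : q ≠ 0) (hr0 : r ≠ 0) (hq : q ^ 2 = y ^ 2 - 1) :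
    coshLength b x z p r - coshLength c x y p q * coshLength a y z q r =
      ((x * z + b) * (y ^ 2 - 1) - (x * y + c) * (y * z + a)) / (p * q ^ 2 * r) := by
  rw [← hq]; unfold coshLength; field_simp

/-- The subtracted term is exactly the contribution of v through the opposite side, so the two
cancel in `hypAngleDeriv` and only the edge coefficient remains. -/
lemma offDiagonal_identity (hp0 : p ≠ 0) (hq0 : q ≠ 0) (hr0 : r ≠ 0) (hp : p ^ 2 = x ^ 2 - 1)
    (hq : q ^ 2 = y ^ 2 - 1) (hn : edgeForm c x y ≠ 0) :
    (x + c * y) / (q ^ 2 * p) *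
      ((coshLength b x z p r - coshLength c x y p q * coshLength a y z q r) /
        (coshLength c x y p q ^ 2 - 1)) =
      edgeWeight a b c x y z r - (z + a * y) / (q ^ 2 * r) := by
  rw [coshLength_sub_mul hp0 hq0 hr0 hq, coshLength_sq_sub_one hp0 hq0 hp hq]
  have key : (x + c * y) * ((x * z + b) * (y ^ 2 - 1) - (x * y + c) * (y * z + a)) +
      (z + a * y) * edgeForm c x y = q ^ 2 * cofactorForm a b c x y z := by
    rw [hq]; unfold edgeForm cofactorForm; ring
  unfold edgeWeight
  field_simp
  linear_combination key

/-- The first term on the right is antisymmetric under exchanging the two edges at the vertex and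
cancels when both contributions are added. -/
lemma diagonal_identity (hp0 : p ≠ 0) (hq0 : q ≠ 0) (hr0 : r ≠ 0) (hp : p ^ 2 = x ^ 2 - 1)
    (hq : q ^ 2 = y ^ 2 - 1) (hn : edgeForm c x y ≠ 0) :
    (y + c * x) / (p ^ 2 * q) *
      ((coshLength b x z p r - coshLength c x y p q * coshLength a y z q r) /
        (coshLength c x y p q ^ 2 - 1)) =
      (b * y - c * z) / (p * q * r) - coshLength c x y p q * edgeWeight a b c x y z r := by
  rw [coshLength_sub_mul hp0 hq0 hr0 hq, coshLength_sq_sub_one hp0 hq0 hp hq]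
  have key : (y + c * x) * ((x * z + b) * (y ^ 2 - 1) - (x * y + c) * (y * z + a)) +
      (x * y + c) * cofactorForm a b c x y z = (b * y - c * z) * edgeForm c x y := by
    unfold edgeForm cofactorForm; ring
  unfold edgeWeight coshLength
  field_simp
  linear_combination key

lemma hypAngleDeriv_coshLength (hp0 : p ≠ 0) (hq0 : q ≠ 0) (hr0 : r ≠ 0) (hp : p ^ 2 = x ^ 2 - 1)
    (hq : q ^ 2 = y ^ 2 - 1) (hr : r ^ 2 = z ^ 2 - 1) (hn3 : edgeForm c x y ≠ 0)
    (hn2 : edgeForm b x z ≠ 0) (u v w : ℝ) :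
    hypAngleDeriv (coshLength c x y p q) (coshLength b x z p r) (coshLength a y z q r)
      (coshLengthDeriv c x y p q u v) (coshLengthDeriv b x z p r u w)
      (coshLengthDeriv a y z q r v w) =
    -(edgeWeight a b c x y z r * (coshLength c x y p q * u - v) +
      edgeWeight a c b x z y q * (coshLength b x z p r * u - w)) := by
  have o3 := offDiagonal_identity (a := a) (b := b) (z := z) hp0 hq0 hr0 hp hq hn3
  have o2 := offDiagonal_identity (a := a) (b := c) (z := y) hp0 hr0 hq0 hp hr hn2
  have d3 := diagonal_identity (a := a) (b := b) (z := z) hp0 hq0 hr0 hp hq hn3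
  have d2 := diagonal_identity (a := a) (b := c) (z := y) hp0 hr0 hq0 hp hr hn2
  rw [coshLength_comm a z y] at o2 d2
  unfold hypAngleDeriv
  simp only [coshLengthDeriv]
  have f : (c * z - b * y) / (p * r * q) = - ((b * y - c * z) / (p * q * r)) := by
    rw [← neg_div, mul_right_comm p r q]; congr 1; ring
  rw [f] at d2
  linear_combination v * o3 + w * o2 + u * d3 + u * d2

/-- `gramDet` of the three sides, up to the factor `(p * q * r) ^ 2`. -/
def sideForm (a b c x y z : ℝ) : ℝ :=
  x * cofactorForm b c a y z x + y * cofactorForm a c b x z y + z * cofactorForm a b c x y z -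
    weightDet a b c

lemma gramDet_coshLength (hp0 : p ≠ 0) (hq0 : q ≠ 0) (hr0 : r ≠ 0) (hp : p ^ 2 = x ^ 2 - 1)
    (hq : q ^ 2 = y ^ 2 - 1) (hr : r ^ 2 = z ^ 2 - 1) :
    gramDet (coshLength c x y p q) (coshLength b x z p r) (coshLength a y z q r) =
      sideForm a b c x y z / (p ^ 2 * q ^ 2 * r ^ 2) := by
  have : gramDet (coshLength c x y p q) (coshLength b x z p r) (coshLength a y z q r) =
      (p ^ 2 * q ^ 2 * r ^ 2 + 2 * (x * y + c) * (x * z + b) * (y * z + a) -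
        (x * y + c) ^ 2 * r ^ 2 - (x * z + b) ^ 2 * q ^ 2 - (y * z + a) ^ 2 * p ^ 2) /
        (p ^ 2 * q ^ 2 * r ^ 2) := by
    unfold gramDet coshLength; field_simp
  rw [this]
  congr 1
  rw [hp, hq, hr]; unfold sideForm cofactorForm weightDet; ring

/-- An entry of the product of the matrix of hyperbolic cosines and the matrix of the form. -/
lemma product_identity (hp0 : p ≠ 0) (hq0 : q ≠ 0) (hr0 : r ≠ 0) (hp : p ^ 2 = x ^ 2 - 1)
    (hq : q ^ 2 = y ^ 2 - 1) (hr : r ^ 2 = z ^ 2 - 1) (hn3 : edgeForm c x y ≠ 0)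
    (hn1 : edgeForm a y z ≠ 0) :
    edgeWeight a b c x y z r * (coshLength c x y p q ^ 2 - 1) +
      edgeWeight b c a y z x p *
        (coshLength c x y p q * coshLength a y z q r - coshLength b x z p r) =
    gramDet (coshLength c x y p q) (coshLength b x z p r) (coshLength a y z q r) *
      (r * (z + a * y) / edgeForm a y z) := by
  have hs := coshLength_sub_mul (a := a) (b := b) (c := c) (x := x) (z := z) hp0 hq0 hr0 hq
  have hs' : coshLength c x y p q * coshLength a y z q r - coshLength b x z p r =
      -(((x * z + b) * (y ^ 2 - 1) - (x * y + c) * (y * z + a)) / (p * q ^ 2 * r)) := by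
    rw [← hs]; ring
  rw [hs', gramDet_coshLength hp0 hq0 hr0 hp hq hr, coshLength_sq_sub_one hp0 hq0 hp hq]
  have key : cofactorForm a b c x y z * edgeForm a y z - cofactorForm b c a y z x *
      ((x * z + b) * (y ^ 2 - 1) - (x * y + c) * (y * z + a)) =
      sideForm a b c x y z * (z + a * y) := by
    unfold edgeForm sideForm cofactorForm weightDet; ring
  unfold edgeWeight
  field_simp
  linear_combination key

end Identities

/-- A symmetric form on `ℝ³` with positive determinant is positive definite if it is positive on two
orthogonal vectors, the first of which is the last basis vector. -/
lemma quadraticForm_three_pos {A B C D E F f g : ℝ} (hC : 0 < C)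
    (horth : E * f + F * g + C = 0)
    (hf : 0 < f * (A * f + D * g + E) + g * (D * f + B * g + F))
    (hdet : 0 < A * B * C + 2 * D * E * F - A * F ^ 2 - B * E ^ 2 - C * D ^ 2)
    {u v w : ℝ} (hne : ¬ (u = 0 ∧ v = 0 ∧ w = 0)) :
    0 < A * u ^ 2 + B * v ^ 2 + C * w ^ 2 + 2 * D * u * v + 2 * E * u * w + 2 * F * v * w := by
  -- α, β, γ are the entries of C times the Schur complement of the last diagonal entry; its
  -- discriminant is C times the full determinant.
  set α := A * C - E ^ 2 with hα
  set β := D * C - E * F with hβ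
  set γ := B * C - F ^ 2 with hγ
  have hdisc : 0 < α * γ - β ^ 2 := by
    have : α * γ - β ^ 2 =
        C * (A * B * C + 2 * D * E * F - A * F ^ 2 - B * E ^ 2 - C * D ^ 2) := by
      rw [hα, hβ, hγ]; ring
    rw [this]; positivity
  have hval : 0 < α * f ^ 2 + 2 * β * f * g + γ * g ^ 2 := by
    have : α * f ^ 2 + 2 * β * f * g + γ * g ^ 2 =
        C * (f * (A * f + D * g + E) + g * (D * f + B * g + F)) := by
      rw [hα, hβ, hγ]
      linear_combination (-(E * f + F * g)) * horth
    rw [this]; positivity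
  -- A binary form with positive discriminant αγ - β² is definite, and the value at (f, g) decides
  -- the sign.
  have hα0 : 0 < α := by
    by_contra! h
    have h1 : α * (α * f ^ 2 + 2 * β * f * g + γ * g ^ 2) =
        (α * f + β * g) ^ 2 + (α * γ - β ^ 2) * g ^ 2 := by ring
    have h2 : 0 ≤ (α * f + β * g) ^ 2 + (α * γ - β ^ 2) * g ^ 2 := by positivity
    have h3 : α = 0 := by
      by_contra h0
      have := mul_neg_of_neg_of_pos (lt_of_le_of_ne h h0) hval
      linarith
    rw [h3] at hdisc
    nlinarith [sq_nonneg β]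
  have hschur : ∀ s t : ℝ, ¬ (s = 0 ∧ t = 0) → 0 < α * s ^ 2 + 2 * β * s * t + γ * t ^ 2 := by
    intro s t hst
    refine pos_of_mul_pos_right (a := α) ?_ hα0.le
    have h1 : α * (α * s ^ 2 + 2 * β * s * t + γ * t ^ 2) =
        (α * s + β * t) ^ 2 + (α * γ - β ^ 2) * t ^ 2 := by ring
    rw [h1]
    by_cases ht : t = 0
    · have hs : s ≠ 0 := fun h => hst ⟨h, ht⟩
      subst ht
      have : 0 < (α * s) ^ 2 := by positivity
      simpa using this
    · have : 0 < (α * γ - β ^ 2) * t ^ 2 := by positivity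
      linarith [sq_nonneg (α * s + β * t)]
  refine pos_of_mul_pos_right (a := C) ?_ hC.le
  have h1 : C * (A * u ^ 2 + B * v ^ 2 + C * w ^ 2 + 2 * D * u * v + 2 * E * u * w +
      2 * F * v * w) = (E * u + F * v + C * w) ^ 2 +
        (α * u ^ 2 + 2 * β * u * v + γ * v ^ 2) := by
    rw [hα, hβ, hγ]; ring
  rw [h1]
  by_cases huv : u = 0 ∧ v = 0
  · obtain ⟨rfl, rfl⟩ := huv
    have hw : w ≠ 0 := fun h => hne ⟨rfl, rfl, h⟩
    have : 0 < (C * w) ^ 2 := by positivity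
    simpa using this
  · linarith [hschur u v huv, sq_nonneg (E * u + F * v + C * w)]

/-! ### Positive definiteness of the hyperbolic form -/

section

variable {a b c x y z p q r : ℝ}

lemma edgeTerm_nonneg {w C : ℝ} (hw : 0 ≤ w) (hC : 1 < C) (u v : ℝ) :
    0 ≤ w * (C * (u ^ 2 + v ^ 2) - 2 * u * v) := by
  have : 0 ≤ C * (u ^ 2 + v ^ 2) - 2 * u * v := by
    nlinarith [sq_nonneg (u - v), mul_nonneg (sub_nonneg.2 hC.le) (add_nonneg (sq_nonneg u)
      (sq_nonneg v))]
  positivity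

lemma edgeTerm_pos {w C : ℝ} (hw : 0 < w) (hC : 1 < C) {u v : ℝ} (h : u ≠ 0 ∨ v ≠ 0) :
    0 < w * (C * (u ^ 2 + v ^ 2) - 2 * u * v) := by
  have h0 : 0 < u ^ 2 + v ^ 2 := by
    rcases h with h | h
    · have : 0 < u ^ 2 := by positivity
      positivity
    · have : 0 < v ^ 2 := by positivity
      positivity
  have : 0 < C * (u ^ 2 + v ^ 2) - 2 * u * v := by
    nlinarith [sq_nonneg (u - v), mul_pos (sub_pos.2 hC) h0]
  positivity

/-- The hyperbolic quadratic form. -/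
noncomputable def hyperbolicForm (a b c x y z p q r u v w : ℝ) : ℝ :=
  edgeWeight a b c x y z r * (coshLength c x y p q * (u ^ 2 + v ^ 2) - 2 * u * v) +
  edgeWeight a c b x z y q * (coshLength b x z p r * (u ^ 2 + w ^ 2) - 2 * u * w) +
  edgeWeight b c a y z x p * (coshLength a y z q r * (v ^ 2 + w ^ 2) - 2 * v * w)

/-- The product of the matrix of the form with the matrix of hyperbolic cosines has zero diagonal,
since (C w₃ + B w₂) - C w₃ - B w₂ = 0 and likewise in the other rows. Its determinant is thus the
sum of the two cyclic products of off-diagonal entries. Each entry carries a factor `gramDet` by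
`product_identity`, and the remaining factors add up to the structure polynomial. -/
lemma hyperbolicForm_det (hp0 : p ≠ 0) (hq0 : q ≠ 0) (hr0 : r ≠ 0) (hp : p ^ 2 = x ^ 2 - 1)
    (hq : q ^ 2 = y ^ 2 - 1) (hr : r ^ 2 = z ^ 2 - 1) (hn1 : edgeForm a y z ≠ 0)
    (hn2 : edgeForm b x z ≠ 0) (hn3 : edgeForm c x y ≠ 0) {A B C w₁ w₂ w₃ : ℝ}
    (hA : A = coshLength a y z q r) (hB : B = coshLength b x z p r)
    (hC : C = coshLength c x y p q) (hw₁ : w₁ = edgeWeight b c a y z x p)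
    (hw₂ : w₂ = edgeWeight a c b x z y q) (hw₃ : w₃ = edgeWeight a b c x y z r) :
    gramDet C B A * ((C * w₃ + B * w₂) * (C * w₃ + A * w₁) * (B * w₂ + A * w₁) +
        2 * (-w₃) * (-w₂) * (-w₁) - (C * w₃ + B * w₂) * (-w₁) ^ 2 -
        (C * w₃ + A * w₁) * (-w₂) ^ 2 - (B * w₂ + A * w₁) * (-w₃) ^ 2) =
      gramDet C B A ^ 3 * (p * q * r * (2 * (1 + a * b * c) * (x * y * z) +
        (a + b * c) * (x * (y ^ 2 + z ^ 2)) + (b + a * c) * (y * (x ^ 2 + z ^ 2)) +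
        (c + a * b) * (z * (x ^ 2 + y ^ 2))) /
          (edgeForm a y z * edgeForm b x z * edgeForm c x y)) := by
  have p12 := product_identity (b := b) hp0 hq0 hr0 hp hq hr hn3 hn1
  have p13 := product_identity (a := a) (b := c) (c := b) (y := z) (z := y) hp0 hr0 hq0 hp hr hq
    hn2 (edgeForm_comm a y z ▸ hn1)
  have p21 := product_identity (a := b) (b := a) (c := c) (x := y) (y := x) (z := z) hq0 hp0 hr0
    hq hp hr (edgeForm_comm c x y ▸ hn3) hn2
  have p23 := product_identity (a := b) (b := c) (c := a) (x := y) (y := z) (z := x) hq0 hr0 hp0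
    hq hr hp hn1 (edgeForm_comm b x z ▸ hn2)
  have p31 := product_identity (a := c) (b := a) (c := b) (x := z) (y := x) (z := y) hr0 hp0 hq0
    hr hp hq (edgeForm_comm b x z ▸ hn2) hn3
  have p32 := product_identity (a := c) (b := b) (c := a) (x := z) (y := y) (z := x) hr0 hq0 hp0
    hr hq hp (edgeForm_comm a y z ▸ hn1) (edgeForm_comm c x y ▸ hn3)
  rw [edgeWeight_swap b c a y z x, coshLength_comm a z y, edgeForm_comm a z y,
    ← hA, ← hB, ← hC, ← hw₁, ← hw₂] at p13
  rw [edgeWeight_swap a b c x y z, coshLength_comm c y x, ← hA, ← hB, ← hC, ← hw₃, ← hw₂] at p21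
  rw [edgeWeight_swap a c b x z y, coshLength_comm c y x, coshLength_comm b z x,
    edgeForm_comm b z x, ← hA, ← hB, ← hC, ← hw₁, ← hw₂] at p23
  rw [edgeWeight_swap a c b x z y, coshLength_comm a z y, coshLength_comm b z x, ← hA, ← hB, ← hC, ← hw₃, ← hw₂] at p31
  rw [edgeWeight_swap b c a y z x, edgeWeight_swap a b c x y z, coshLength_comm a z y,
    coshLength_comm b z x, coshLength_comm c y x, edgeForm_comm c y x,
    ← hA, ← hB, ← hC, ← hw₃, ← hw₁] at p32
  rw [← hA, ← hB, ← hC, ← hw₃, ← hw₁] at p12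
  have g13 : gramDet B C A = gramDet C B A := by unfold gramDet; ring
  have g21 : gramDet C A B = gramDet C B A := by unfold gramDet; ring
  have g23 : gramDet A C B = gramDet C B A := by unfold gramDet; ring
  have g31 : gramDet B A C = gramDet C B A := by unfold gramDet; ring
  have g32 : gramDet A B C = gramDet C B A := by unfold gramDet; ring
  rw [g13] at p13
  rw [g21] at p21
  rw [g23] at p23
  rw [g31] at p31
  rw [g32] at p32
  have prod : gramDet C B A * ((C * w₃ + B * w₂) * (C * w₃ + A * w₁) * (B * w₂ + A * w₁) +
        2 * (-w₃) * (-w₂) * (-w₁) - (C * w₃ + B * w₂) * (-w₁) ^ 2 -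
        (C * w₃ + A * w₁) * (-w₂) ^ 2 - (B * w₂ + A * w₁) * (-w₃) ^ 2) =
      (w₃ * (C ^ 2 - 1) + w₁ * (C * A - B)) * (w₁ * (A ^ 2 - 1) + w₂ * (A * B - C)) *
        (w₂ * (B ^ 2 - 1) + w₃ * (B * C - A)) +
      (w₂ * (B ^ 2 - 1) + w₁ * (B * A - C)) * (w₃ * (C ^ 2 - 1) + w₂ * (C * B - A)) *
        (w₁ * (A ^ 2 - 1) + w₃ * (A * C - B)) := by
    unfold gramDet; ring
  rw [prod, p12, p13, p21, p23, p31, p32]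
  field_simp
  ring

lemma hyperbolicForm_pos_of_two_pos (ha : -1 < a) (hb : -1 < b) (hc : -1 < c)
    (hx : 0 < x) (hy : 0 < y) (hz : 0 < z) (hp0 : 0 < p) (hq0 : 0 < q) (hr0 : 0 < r)
    (hp : p ^ 2 = x ^ 2 - 1) (hq : q ^ 2 = y ^ 2 - 1) (hr : r ^ 2 = z ^ 2 - 1)
    (h1 : 0 ≤ a + b * c) (h2 : 0 ≤ b + a * c) (h3 : 0 ≤ c + a * b)
    (hD : 0 < gramDet (coshLength c x y p q) (coshLength b x z p r) (coshLength a y z q r))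
    (p1 : 0 < cofactorForm b c a y z x) (p2 : 0 < cofactorForm a c b x z y)
    {u v w : ℝ} (hne : ¬ (u = 0 ∧ v = 0 ∧ w = 0)) :
    0 < hyperbolicForm a b c x y z p q r u v w := by
  have n1 := edgeForm_pos ha hy hz hq0 hr0 hq hr
  have n2 := edgeForm_pos hb hx hz hp0 hr0 hp hr
  have n3 := edgeForm_pos hc hx hy hp0 hq0 hp hq
  have l1 := one_lt_coshLength ha hy hz hq0 hr0 hq hr
  have l2 := one_lt_coshLength hb hx hz hp0 hr0 hp hr
  have l3 := one_lt_coshLength hc hx hy hp0 hq0 hp hq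
  have w1 : 0 < edgeWeight b c a y z x p := by unfold edgeWeight; positivity
  have w2 : 0 < edgeWeight a c b x z y q := by unfold edgeWeight; positivity
  unfold hyperbolicForm
  -- For -1 < c < 0 the third coefficient is positive as well, and the form is a sum of nonnegative
  -- edge terms. For c ≥ 0 it may be negative, but then y + c x and x + c y are positive.
  rcases lt_or_ge c 0 with hc0 | hc0
  · have p3 : 0 < cofactorForm a b c x y z := by
      have t1 : 0 < (1 - c ^ 2) * z := mul_pos (by nlinarith) hz
      have t2 := mul_nonneg h2 hx.le
      have t3 := mul_nonneg h1 hy.le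
      unfold cofactorForm; linarith
    have w3 : 0 < edgeWeight a b c x y z r := by unfold edgeWeight; positivity
    have e1 := edgeTerm_nonneg w1.le l1 v w
    have e2 := edgeTerm_nonneg w2.le l2 u w
    have e3 := edgeTerm_nonneg w3.le l3 u v
    by_cases huv : u ≠ 0 ∨ v ≠ 0
    · linarith [edgeTerm_pos w3 l3 huv]
    · have hw : w ≠ 0 := by
        push Not at huv
        exact fun h => hne ⟨huv.1, huv.2, h⟩
      linarith [edgeTerm_pos w1 l1 (u := v) (Or.inr hw)]
  · have hdet := hyperbolicForm_det (a := a) (b := b) (c := c) hp0.ne' hq0.ne' hr0.ne' hp hq hr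
      n1.ne' n2.ne' n3.ne' rfl rfl rfl rfl rfl rfl
    have hT := structure_poly_pos ha hb hc hx hy hz h1 h2 h3
    have p31 := product_identity (a := c) (b := a) (c := b) (x := z) (y := x) (z := y) hr0.ne'
      hp0.ne' hq0.ne' hr hp hq (edgeForm_comm b x z ▸ n2.ne') n3.ne'
    have p32 := product_identity (a := c) (b := b) (c := a) (x := z) (y := y) (z := x) hr0.ne'
      hq0.ne' hp0.ne' hr hq hp (edgeForm_comm a y z ▸ n1.ne') (edgeForm_comm c x y ▸ n3.ne')
    rw [edgeWeight_swap a c b x z y, coshLength_comm a z y, coshLength_comm b z x] at p31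
    rw [edgeWeight_swap b c a y z x, edgeWeight_swap a b c x y z, coshLength_comm a z y,
      coshLength_comm b z x, coshLength_comm c y x, edgeForm_comm c y x] at p32
    set A := coshLength a y z q r
    set B := coshLength b x z p r
    set C := coshLength c x y p q
    set w₁ := edgeWeight b c a y z x p
    set w₂ := edgeWeight a c b x z y q
    set w₃ := edgeWeight a b c x y z r
    have g31 : gramDet B A C = gramDet C B A := by unfold gramDet; ring
    have g32 : gramDet A B C = gramDet C B A := by unfold gramDet; ring
    rw [g31] at p31
    rw [g32] at p32
    have q31 : 0 < gramDet C B A * (q * (y + c * x) / edgeForm c x y) := by positivity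
    have q32 : 0 < gramDet C B A * (p * (x + c * y) / edgeForm c x y) := by positivity
    rw [← p31] at q31
    rw [← p32] at q32
    have hdet0 : 0 < gramDet C B A * ((C * w₃ + B * w₂) * (C * w₃ + A * w₁) * (B * w₂ + A * w₁) +
        2 * (-w₃) * (-w₂) * (-w₁) - (C * w₃ + B * w₂) * (-w₁) ^ 2 -
        (C * w₃ + A * w₁) * (-w₂) ^ 2 - (B * w₂ + A * w₁) * (-w₃) ^ 2) := by
      rw [hdet]; positivity
    have hdet1 := pos_of_mul_pos_right hdet0 hD.le
    have hA0 : 0 < A := by linarith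
    have hB0 : 0 < B := by linarith
    -- The vector (B, A, 1) is the third column of the matrix of hyperbolic cosines. The form's
    -- matrix sends it to a vector with last entry 0 and positive first two entries by
    -- `product_identity`.
    have := quadraticForm_three_pos (C := B * w₂ + A * w₁) (E := -w₂) (F := -w₁) (f := B) (g := A)
      (by positivity) (by ring) ?_ hdet1 hne
    · linarith
    · have e : B * ((C * w₃ + B * w₂) * B + -w₃ * A + -w₂) +
          A * (-w₃ * B + (C * w₃ + A * w₁) * A + -w₁) =
          B * (w₂ * (B ^ 2 - 1) + w₃ * (B * C - A)) +
          A * (w₁ * (A ^ 2 - 1) + w₃ * (A * C - B)) := by ring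
      rw [e]
      exact add_pos (mul_pos hB0 q31) (mul_pos hA0 q32)

lemma hyperbolicForm_swap (u v w : ℝ) :
    hyperbolicForm a c b x z y p r q u w v = hyperbolicForm a b c x y z p q r u v w := by
  unfold hyperbolicForm
  rw [edgeWeight_swap b c a y z x, coshLength_comm a z y]
  ring

lemma hyperbolicForm_rev (u v w : ℝ) :
    hyperbolicForm c b a z y x r q p w v u = hyperbolicForm a b c x y z p q r u v w := by
  unfold hyperbolicForm
  rw [edgeWeight_swap b c a y z x, edgeWeight_swap a c b x z y, edgeWeight_swap a b c x y z,
    coshLength_comm a z y, coshLength_comm b z x, coshLength_comm c y x]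
  ring

/-- A combination of the three forms with positive coefficients p², xy + c, xz + b equals `sideForm`
times x. -/
lemma cofactorForm_pos_of_sideForm (hb : -1 < b) (hc : -1 < c)
    (hx : 0 < x) (hy : 0 < y) (hz : 0 < z) (hp0 : 0 < p) (hq0 : 0 < q) (hr0 : 0 < r)
    (hp : p ^ 2 = x ^ 2 - 1) (hq : q ^ 2 = y ^ 2 - 1) (hr : r ^ 2 = z ^ 2 - 1)
    (hS : 0 < sideForm a b c x y z) :
    0 < cofactorForm b c a y z x ∨ 0 < cofactorForm a c b x z y ∨ 0 < cofactorForm a b c x y z := by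
  by_contra! h
  obtain ⟨n1, n2, n3⟩ := h
  have l2 : 0 < x * z + b := by
    have := one_lt_coshLength hb hx hz hp0 hr0 hp hr
    unfold coshLength at this
    exact pos_of_mul_pos_left (b := (p * r)⁻¹) (by rw [← div_eq_mul_inv]; linarith) (by positivity)
  have l3 : 0 < x * y + c := by
    have := one_lt_coshLength hc hx hy hp0 hq0 hp hq
    unfold coshLength at this
    exact pos_of_mul_pos_left (b := (p * q)⁻¹) (by rw [← div_eq_mul_inv]; linarith) (by positivity)
  have key : p ^ 2 * cofactorForm b c a y z x + (x * y + c) * cofactorForm a c b x z y +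
      (x * z + b) * cofactorForm a b c x y z = sideForm a b c x y z * x := by
    rw [hp]; unfold sideForm cofactorForm weightDet; ring
  have s1 := mul_nonpos_of_nonneg_of_nonpos (sq_nonneg p) n1
  have s2 := mul_nonpos_of_nonneg_of_nonpos l3.le n2
  have s3 := mul_nonpos_of_nonneg_of_nonpos l2.le n3
  linarith [mul_pos hS hx]

lemma hyperbolicForm_pos (ha : -1 < a) (hb : -1 < b) (hc : -1 < c)
    (hx : 0 < x) (hy : 0 < y) (hz : 0 < z) (hp0 : 0 < p) (hq0 : 0 < q) (hr0 : 0 < r)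
    (hp : p ^ 2 = x ^ 2 - 1) (hq : q ^ 2 = y ^ 2 - 1) (hr : r ^ 2 = z ^ 2 - 1)
    (h1 : 0 ≤ a + b * c) (h2 : 0 ≤ b + a * c) (h3 : 0 ≤ c + a * b)
    (hD : 0 < gramDet (coshLength c x y p q) (coshLength b x z p r) (coshLength a y z q r))
    {u v w : ℝ} (hne : ¬ (u = 0 ∧ v = 0 ∧ w = 0)) :
    0 < hyperbolicForm a b c x y z p q r u v w := by
  have hS : 0 < sideForm a b c x y z := by
    rw [gramDet_coshLength hp0.ne' hq0.ne' hr0.ne' hp hq hr] at hD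
    have : 0 < p ^ 2 * q ^ 2 * r ^ 2 := by positivity
    exact (div_pos_iff_of_pos_right this).1 hD
  rcases cofactorForm_two_pos ha hb hc hx hy hz h1 h2 h3
    (cofactorForm_pos_of_sideForm hb hc hx hy hz hp0 hq0 hr0 hp hq hr hS) with
    ⟨k, l⟩ | ⟨k, l⟩ | ⟨k, l⟩
  · exact hyperbolicForm_pos_of_two_pos ha hb hc hx hy hz hp0 hq0 hr0 hp hq hr h1 h2 h3 hD k l hne
  · rw [← hyperbolicForm_swap]
    refine hyperbolicForm_pos_of_two_pos ha hc hb hx hz hy hp0 hr0 hq0 hp hr hq (by linarith) h3 h2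
      ?_ (by rwa [cofactorForm_swap]) l (by tauto)
    rw [coshLength_comm a z y]
    unfold gramDet at hD ⊢; linarith
  · rw [← hyperbolicForm_rev]
    refine hyperbolicForm_pos_of_two_pos hc hb ha hz hy hx hr0 hq0 hp0 hr hq hp (by linarith)
      (by linarith) (by linarith) ?_ (by rwa [cofactorForm_swap]) (by rwa [cofactorForm_swap])
      (by tauto)
    rw [coshLength_comm a z y, coshLength_comm b z x, coshLength_comm c y x]
    unfold gramDet at hD ⊢; linarith

/-- The derivative of the pairing of the hyperbolic angles with the direction of motion is negative,
up to the positive factor `√(gramDet A B C)`. -/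
lemma sum_hypAngleDeriv_neg (ha : -1 < a) (hb : -1 < b) (hc : -1 < c)
    (hx : 0 < x) (hy : 0 < y) (hz : 0 < z) (hp0 : 0 < p) (hq0 : 0 < q) (hr0 : 0 < r)
    (hp : p ^ 2 = x ^ 2 - 1) (hq : q ^ 2 = y ^ 2 - 1) (hr : r ^ 2 = z ^ 2 - 1)
    (h1 : 0 ≤ a + b * c) (h2 : 0 ≤ b + a * c) (h3 : 0 ≤ c + a * b)
    (hD : 0 < gramDet (coshLength c x y p q) (coshLength b x z p r) (coshLength a y z q r))
    {u v w : ℝ} (hne : ¬ (u = 0 ∧ v = 0 ∧ w = 0)) :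
    u * hypAngleDeriv (coshLength c x y p q) (coshLength b x z p r) (coshLength a y z q r)
        (coshLengthDeriv c x y p q u v) (coshLengthDeriv b x z p r u w)
        (coshLengthDeriv a y z q r v w) +
      v * hypAngleDeriv (coshLength c x y p q) (coshLength a y z q r) (coshLength b x z p r)
        (coshLengthDeriv c x y p q u v) (coshLengthDeriv a y z q r v w)
        (coshLengthDeriv b x z p r u w) +
      w * hypAngleDeriv (coshLength b x z p r) (coshLength a y z q r) (coshLength c x y p q)
        (coshLengthDeriv b x z p r u w) (coshLengthDeriv a y z q r v w)
        (coshLengthDeriv c x y p q u v) < 0 := by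
  have n1 := (edgeForm_pos ha hy hz hq0 hr0 hq hr).ne'
  have n2 := (edgeForm_pos hb hx hz hp0 hr0 hp hr).ne'
  have n3 := (edgeForm_pos hc hx hy hp0 hq0 hp hq).ne'
  have e1 := hypAngleDeriv_coshLength hp0.ne' hq0.ne' hr0.ne' hp hq hr n3 n2 u v w (a := a)
  have e2 := hypAngleDeriv_coshLength (a := b) (b := a) (c := c) (x := y) (y := x) (z := z)
    hq0.ne' hp0.ne' hr0.ne' hq hp hr (edgeForm_comm c x y ▸ n3) n1 v u w
  have e3 := hypAngleDeriv_coshLength (a := c) (b := a) (c := b) (x := z) (y := x) (z := y)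
    hr0.ne' hp0.ne' hq0.ne' hr hp hq (edgeForm_comm b x z ▸ n2) (edgeForm_comm a y z ▸ n1) w u v
  rw [coshLength_comm c y x, coshLengthDeriv_comm c y x, edgeWeight_swap a b c x y z] at e2
  rw [coshLength_comm b z x, coshLengthDeriv_comm b z x, coshLength_comm a z y,
    coshLengthDeriv_comm a z y, edgeWeight_swap a c b x z y, edgeWeight_swap b c a y z x] at e3
  rw [e1, e2, e3]
  have := hyperbolicForm_pos ha hb hc hx hy hz hp0 hq0 hr0 hp hq hr h1 h2 h3 hD hne
  unfold hyperbolicForm at this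
  linear_combination this

end

/-! ### Angles as functions of the side lengths -/

lemma euclideanAngle_comm (a b c : ℝ) : euclideanAngle b a c = euclideanAngle a b c := by
  unfold euclideanAngle; congr 1; ring

lemma hyperbolicAngle_comm (a b c : ℝ) : hyperbolicAngle b a c = hyperbolicAngle a b c := by
  unfold hyperbolicAngle; congr 1; ring

lemma euclideanAngle_sqrt {A B C : ℝ} (hA : 0 ≤ A) (hB : 0 ≤ B) (hC : 0 ≤ C) :
    euclideanAngle √A √B √C = Real.arccos ((A + B - C) / √(4 * A * B)) := by
  have e : √(4 * A * B) = 2 * √A * √B := by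
    rw [Real.sqrt_mul (by positivity), Real.sqrt_mul (by norm_num),
      show (4 : ℝ) = 2 ^ 2 by norm_num, Real.sqrt_sq (by norm_num)]
  rw [euclideanAngle, Real.sq_sqrt hA, Real.sq_sqrt hB, Real.sq_sqrt hC, e]

lemma hyperbolicAngle_arcosh {A B C : ℝ} (hA : 1 ≤ A) (hB : 1 ≤ B) (hC : 1 ≤ C) :
    hyperbolicAngle (Real.arcosh A) (Real.arcosh B) (Real.arcosh C) =
      Real.arccos ((A * B - C) / √((A ^ 2 - 1) * (B ^ 2 - 1))) := by
  rw [hyperbolicAngle, Real.cosh_arcosh hA, Real.cosh_arcosh hB, Real.cosh_arcosh hC,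
    Real.sinh_arcosh hA, Real.sinh_arcosh hB, ← Real.sqrt_mul (by nlinarith)]

lemma hasDerivAt_euclideanAngle {A B C : ℝ → ℝ} {A' B' C' t : ℝ} (hA : HasDerivAt A A' t)
    (hB : HasDerivAt B B' t) (hC : HasDerivAt C C' t) (hA0 : 0 < A t) (hB0 : 0 < B t)
    (hC0 : 0 < C t) (hH : 0 < heron (A t) (B t) (C t)) :
    HasDerivAt (fun t => euclideanAngle √(A t) √(B t) √(C t))
      (angleDeriv (A t) (B t) (C t) A' B' C' / √(heron (A t) (B t) (C t))) t := by
  have h := hasDerivAt_arccos_div_sqrt ((hA.add hB).sub hC) ((hA.const_mul 4).mul hB)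
    (by simp only [Pi.mul_apply]; positivity) (by simpa [heron] using hH)
  have hev : (fun t => euclideanAngle √(A t) √(B t) √(C t)) =ᶠ[nhds t]
      fun t => Real.arccos ((A + B - C) t / √(((fun t => 4 * A t) * B) t)) := by
    filter_upwards [hA.continuousAt.eventually (lt_mem_nhds hA0),
      hB.continuousAt.eventually (lt_mem_nhds hB0),
      hC.continuousAt.eventually (lt_mem_nhds hC0)] with s h1 h2 h3
    rw [euclideanAngle_sqrt h1.le h2.le h3.le]
    simp
  refine (h.congr_of_eventuallyEq hev).congr_deriv ?_
  simp only [Pi.mul_apply, Pi.add_apply, Pi.sub_apply]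
  have e : 4 * A t * B t - (A t + B t - C t) ^ 2 = heron (A t) (B t) (C t) := rfl
  rw [e]
  congr 1
  unfold angleDeriv
  field_simp

lemma hasDerivAt_hyperbolicAngle {A B C : ℝ → ℝ} {A' B' C' t : ℝ} (hA : HasDerivAt A A' t)
    (hB : HasDerivAt B B' t) (hC : HasDerivAt C C' t) (hA0 : 1 < A t) (hB0 : 1 < B t)
    (hC0 : 1 < C t) (hH : 0 < gramDet (A t) (B t) (C t)) :
    HasDerivAt (fun t => hyperbolicAngle (Real.arcosh (A t)) (Real.arcosh (B t))
      (Real.arcosh (C t)))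
      (hypAngleDeriv (A t) (B t) (C t) A' B' C' / √(gramDet (A t) (B t) (C t))) t := by
  have hA1 : 0 < A t ^ 2 - 1 := by nlinarith
  have hB1 : 0 < B t ^ 2 - 1 := by nlinarith
  have hg : (A t ^ 2 - 1) * (B t ^ 2 - 1) - (A t * B t - C t) ^ 2 =
      gramDet (A t) (B t) (C t) := by unfold gramDet; ring
  have h := hasDerivAt_arccos_div_sqrt (n := fun t => A t * B t - C t)
    (p := fun t => (A t ^ 2 - 1) * (B t ^ 2 - 1)) ((hA.mul hB).sub hC)
    (((hA.pow 2).sub_const 1).mul ((hB.pow 2).sub_const 1))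
    (mul_pos hA1 hB1) (by rw [hg]; exact hH)
  have hev : (fun t => hyperbolicAngle (Real.arcosh (A t)) (Real.arcosh (B t))
      (Real.arcosh (C t))) =ᶠ[nhds t]
      fun t => Real.arccos ((A t * B t - C t) / √((A t ^ 2 - 1) * (B t ^ 2 - 1))) := by
    filter_upwards [hA.continuousAt.eventually (lt_mem_nhds hA0),
      hB.continuousAt.eventually (lt_mem_nhds hB0),
      hC.continuousAt.eventually (lt_mem_nhds hC0)] with s h1 h2 h3
    rw [hyperbolicAngle_arcosh h1.le h2.le h3.le]
  refine (h.congr_of_eventuallyEq hev).congr_deriv ?_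
  rw [hg]
  congr 1
  simp only [Pi.pow_apply]
  unfold hypAngleDeriv
  field_simp
  ring

/-- No triangle inequality is needed, because `Real.arccos` is continuous on the whole line; the
angle thus extends continuously to degenerate sides. -/
lemma continuousAt_euclideanAngle {A B C : ℝ → ℝ} {t : ℝ} (hA : ContinuousAt A t)
    (hB : ContinuousAt B t) (hC : ContinuousAt C t) (hA0 : 0 < A t) (hB0 : 0 < B t) :
    ContinuousAt (fun t => euclideanAngle √(A t) √(B t) √(C t)) t := by
  unfold euclideanAngle
  have h1 : √(A t) ≠ 0 := (Real.sqrt_pos.2 hA0).ne'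
  have h2 : √(B t) ≠ 0 := (Real.sqrt_pos.2 hB0).ne'
  refine Real.continuous_arccos.continuousAt.comp ?_
  exact ContinuousAt.div (by fun_prop) (by fun_prop) (by positivity)

lemma continuousAt_hyperbolicAngle {A B C : ℝ → ℝ} {t : ℝ} (hA : ContinuousAt A t)
    (hB : ContinuousAt B t) (hC : ContinuousAt C t) (hA0 : 1 < A t) (hB0 : 1 < B t)
    (hC0 : 1 < C t) :
    ContinuousAt (fun t => hyperbolicAngle (Real.arcosh (A t)) (Real.arcosh (B t))
      (Real.arcosh (C t))) t := by
  have hev : (fun t => hyperbolicAngle (Real.arcosh (A t)) (Real.arcosh (B t))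
      (Real.arcosh (C t))) =ᶠ[nhds t]
      fun t => Real.arccos ((A t * B t - C t) / √((A t ^ 2 - 1) * (B t ^ 2 - 1))) := by
    filter_upwards [hA.eventually (lt_mem_nhds hA0), hB.eventually (lt_mem_nhds hB0),
      hC.eventually (lt_mem_nhds hC0)] with s h1 h2 h3
    rw [hyperbolicAngle_arcosh h1.le h2.le h3.le]
  refine ContinuousAt.congr ?_ hev.symm
  have hA1 : 0 < A t ^ 2 - 1 := by nlinarith
  have hB1 : 0 < B t ^ 2 - 1 := by nlinarith
  refine Real.continuous_arccos.continuousAt.comp ?_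
  exact ContinuousAt.div (by fun_prop) (by fun_prop) (Real.sqrt_pos.2 (mul_pos hA1 hB1)).ne'

/-! ### Degenerate triangles -/

/-- When the triangle inequality fails, the cosine leaves (-1, 1) and `Real.arccos` takes its
boundary value; this also covers l + m < n. -/
lemma euclideanAngle_eq_pi {l m n : ℝ} (hl : 0 < l) (hm : 0 < m) (h : l + m ≤ n) :
    euclideanAngle l m n = Real.pi := by
  rw [euclideanAngle, Real.arccos_eq_pi, div_le_iff₀ (by positivity)]
  nlinarith

lemma euclideanAngle_eq_zero {l m n : ℝ} (hl : 0 < l) (hm : 0 < m) (hn : 0 < n) (h : l + m ≤ n) :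
    euclideanAngle l n m = 0 := by
  rw [euclideanAngle, Real.arccos_eq_zero, one_le_div (by positivity)]
  nlinarith

lemma hyperbolicAngle_eq_pi {l m n : ℝ} (hl : 0 < l) (hm : 0 < m) (h : l + m ≤ n) :
    hyperbolicAngle l m n = Real.pi := by
  have h1 := Real.sinh_pos_iff.2 hl
  have h2 := Real.sinh_pos_iff.2 hm
  have h3 : Real.cosh (l + m) ≤ Real.cosh n := by
    rw [Real.cosh_le_cosh, abs_of_pos (by linarith), abs_of_pos (by linarith)]; exact h
  rw [Real.cosh_add] at h3
  rw [hyperbolicAngle, Real.arccos_eq_pi, div_le_iff₀ (by positivity)]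
  linarith

lemma hyperbolicAngle_eq_zero {l m n : ℝ} (hl : 0 < l) (hm : 0 < m) (hn : 0 < n)
    (h : l + m ≤ n) : hyperbolicAngle l n m = 0 := by
  have h1 := Real.sinh_pos_iff.2 hl
  have h2 := Real.sinh_pos_iff.2 hn
  have h3 : Real.cosh m ≤ Real.cosh (n - l) := by
    rw [Real.cosh_le_cosh, abs_of_pos hm, abs_of_pos (by linarith)]; linarith
  rw [Real.cosh_sub] at h3
  rw [hyperbolicAngle, Real.arccos_eq_zero, one_le_div (by positivity)]
  linarith

lemma exists_le_of_heron_nonpos {l m n : ℝ} (hl : 0 < l) (hm : 0 < m) (hn : 0 < n)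
    (h : heron (l ^ 2) (m ^ 2) (n ^ 2) ≤ 0) : l + m ≤ n ∨ l + n ≤ m ∨ m + n ≤ l := by
  by_contra! hs
  obtain ⟨h1, h2, h3⟩ := hs
  have e : heron (l ^ 2) (m ^ 2) (n ^ 2) =
      (l + m + n) * (l + m - n) * (l + n - m) * (m + n - l) := by unfold heron; ring
  rw [e] at h
  have := mul_pos (mul_pos (mul_pos (show 0 < l + m + n by linarith) (sub_pos.2 h1))
    (sub_pos.2 h2)) (sub_pos.2 h3)
  linarith

lemma exists_le_of_gramDet_nonpos {l m n : ℝ} (hl : 0 < l) (hm : 0 < m) (hn : 0 < n)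
    (h : gramDet (Real.cosh l) (Real.cosh m) (Real.cosh n) ≤ 0) :
    l + m ≤ n ∨ l + n ≤ m ∨ m + n ≤ l := by
  by_contra! hs
  obtain ⟨h1, h2, h3⟩ := hs
  have c1 : Real.cosh n < Real.cosh (l + m) := by
    rw [Real.cosh_lt_cosh, abs_of_pos hn, abs_of_pos (by linarith)]; exact h1
  have c2 : Real.cosh (l - m) < Real.cosh n := by
    rw [Real.cosh_lt_cosh, abs_of_pos hn, abs_lt]; constructor <;> linarith
  rw [Real.cosh_add] at c1
  rw [Real.cosh_sub] at c2
  -- The hyperbolic Heron factorization: the factors are cosh n - cosh (l - m) and cosh (l + m) -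
  -- cosh n, up to order.
  have e : gramDet (Real.cosh l) (Real.cosh m) (Real.cosh n) =
      (Real.sinh l * Real.sinh m - (Real.cosh l * Real.cosh m - Real.cosh n)) *
      (Real.sinh l * Real.sinh m + (Real.cosh l * Real.cosh m - Real.cosh n)) := by
    have e1 := Real.sinh_sq l
    have e2 := Real.sinh_sq m
    unfold gramDet
    linear_combination (1 - Real.cosh m ^ 2) * e1 - Real.sinh l ^ 2 * e2
  rw [e] at h
  have := mul_pos (show 0 < Real.sinh l * Real.sinh m - (Real.cosh l * Real.cosh m - Real.cosh n)
    by linarith) (show 0 < Real.sinh l * Real.sinh m + (Real.cosh l * Real.cosh m - Real.cosh n)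
    by linarith)
  linarith

/-- The angles are π opposite the longest side and 0 elsewhere, so along a path the pairing meets
only three values at degenerate triangles. -/
lemma euclideanAngle_pairing_degenerate {l m n : ℝ} (hl : 0 < l) (hm : 0 < m) (hn : 0 < n)
    (h : heron (l ^ 2) (m ^ 2) (n ^ 2) ≤ 0) (u v w : ℝ) :
    u * euclideanAngle l m n + v * euclideanAngle l n m + w * euclideanAngle m n l ∈
      ({u * Real.pi, v * Real.pi, w * Real.pi} : Set ℝ) := by
  rcases exists_le_of_heron_nonpos hl hm hn h with h | h | h
  · rw [euclideanAngle_eq_pi hl hm h, euclideanAngle_eq_zero hl hm hn h,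
      euclideanAngle_eq_zero hm hl hn (by linarith)]
    simp
  · rw [euclideanAngle_eq_pi hl hn h, euclideanAngle_eq_zero hl hn hm h,
      euclideanAngle_comm n m l, euclideanAngle_eq_zero hn hl hm (by linarith)]
    simp
  · rw [euclideanAngle_eq_pi hm hn h, euclideanAngle_comm m l n, euclideanAngle_comm n l m,
      euclideanAngle_eq_zero hm hn hl h, euclideanAngle_eq_zero hn hm hl (by linarith)]
    simp

lemma hyperbolicAngle_pairing_degenerate {l m n : ℝ} (hl : 0 < l) (hm : 0 < m) (hn : 0 < n)
    (h : gramDet (Real.cosh l) (Real.cosh m) (Real.cosh n) ≤ 0) (u v w : ℝ) :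
    u * hyperbolicAngle l m n + v * hyperbolicAngle l n m + w * hyperbolicAngle m n l ∈
      ({u * Real.pi, v * Real.pi, w * Real.pi} : Set ℝ) := by
  rcases exists_le_of_gramDet_nonpos hl hm hn h with h | h | h
  · rw [hyperbolicAngle_eq_pi hl hm h, hyperbolicAngle_eq_zero hl hm hn h,
      hyperbolicAngle_eq_zero hm hl hn (by linarith)]
    simp
  · rw [hyperbolicAngle_eq_pi hl hn h, hyperbolicAngle_eq_zero hl hn hm h,
      hyperbolicAngle_comm n m l, hyperbolicAngle_eq_zero hn hl hm (by linarith)]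
    simp
  · rw [hyperbolicAngle_eq_pi hm hn h, hyperbolicAngle_comm m l n, hyperbolicAngle_comm n l m,
      hyperbolicAngle_eq_zero hm hn hl h, hyperbolicAngle_eq_zero hn hm hl (by linarith)]
    simp

/-! ### Nondegenerate triangles -/

lemma heron_pos_of_isEuclideanTriangle {l m n : ℝ} (h : IsEuclideanTriangle l m n) :
    0 < heron (l ^ 2) (m ^ 2) (n ^ 2) := by
  obtain ⟨p, q, s, hind, rfl, rfl, rfl⟩ := h
  have hcol : ¬ Collinear ℝ {p, q, s} := affineIndependent_iff_not_collinear_set.1 hind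
  have strict : ∀ x y z : EuclideanSpace ℝ (Fin 2), ({x, y, z} : Set _) = {p, q, s} →
      dist x z < dist x y + dist y z := by
    intro x y z hxyz
    refine lt_of_le_of_ne (dist_triangle _ _ _) fun he => hcol ?_
    rw [← hxyz]
    exact (dist_add_dist_eq_iff.1 he.symm).collinear
  have h1 := strict p q s rfl
  have h2 := strict p s q (by ext; simp; tauto)
  have h3 := strict q p s (by ext; simp; tauto)
  rw [dist_comm s q] at h2
  rw [dist_comm q p] at h3
  by_contra! hn
  have d1 : 0 < dist p q := by linarith
  have d2 : 0 < dist p s := by linarith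
  have d3 : 0 < dist q s := by linarith
  rcases exists_le_of_heron_nonpos d1 d2 d3 hn with h | h | h <;> linarith

/-- The numerator is the determinant with rows (1, Re z, |z|²), up to sign. It vanishes exactly when
some nontrivial equation α |z|² + β Re z + γ = 0 holds at all three points, which is the equation of
a hyperbolic line. -/
lemma gramDet_dist_eq_sq (p q s : UpperHalfPlane) :
    gramDet (Real.cosh (dist p q)) (Real.cosh (dist p s)) (Real.cosh (dist q s)) =
      (((p.re ^ 2 + p.im ^ 2) * (q.re - s.re) + (q.re ^ 2 + q.im ^ 2) * (s.re - p.re) +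
        (s.re ^ 2 + s.im ^ 2) * (p.re - q.re)) / (2 * p.im * q.im * s.im)) ^ 2 := by
  have hp := p.im_ne_zero
  have hq := q.im_ne_zero
  have hs := s.im_ne_zero
  simp only [UpperHalfPlane.cosh_dist']
  unfold gramDet
  field_simp
  ring

lemma exists_hyperbolicLine {p q s : UpperHalfPlane} (hpq : p.re ≠ q.re)
    (h : (p.re ^ 2 + p.im ^ 2) * (q.re - s.re) + (q.re ^ 2 + q.im ^ 2) * (s.re - p.re) +
        (s.re ^ 2 + s.im ^ 2) * (p.re - q.re) = 0) :
    ∃ L, IsHyperbolicLine L ∧ p ∈ L ∧ q ∈ L ∧ s ∈ L := by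
  have hd : p.re - q.re ≠ 0 := sub_ne_zero.2 hpq
  -- The point of the real axis equidistant from p and q; the determinant condition then puts s at
  -- the same distance.
  set x : ℝ := ((p.re ^ 2 + p.im ^ 2) - (q.re ^ 2 + q.im ^ 2)) / (2 * (p.re - q.re)) with hx
  have hx' : 2 * (p.re - q.re) * x = (p.re ^ 2 + p.im ^ 2) - (q.re ^ 2 + q.im ^ 2) := by
    rw [hx]; field_simp
  have hdist : ∀ z : UpperHalfPlane, dist (z : ℂ) (x : ℂ) = √((z.re - x) ^ 2 + z.im ^ 2) := by
    intro z
    rw [Complex.dist_eq_re_im]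
    simp
  have hq : (q.re - x) ^ 2 + q.im ^ 2 = (p.re - x) ^ 2 + p.im ^ 2 := by
    linear_combination hx'
  have hs : (s.re - x) ^ 2 + s.im ^ 2 = (p.re - x) ^ 2 + p.im ^ 2 := by
    refine mul_right_cancel₀ hd ?_
    linear_combination h - (s.re - p.re) * hx'
  refine ⟨_, Or.inr ⟨x, √((p.re - x) ^ 2 + p.im ^ 2), ?_, rfl⟩, hdist p, ?_, ?_⟩
  · have := p.im_pos
    positivity
  · rw [Set.mem_ofPred_eq, hdist, hq]
  · rw [Set.mem_ofPred_eq, hdist, hs]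

lemma gramDet_pos_of_isHyperbolicTriangle {l m n : ℝ} (h : IsHyperbolicTriangle l m n) :
    0 < gramDet (Real.cosh l) (Real.cosh m) (Real.cosh n) := by
  obtain ⟨p, q, s, hline, rfl, rfl, rfl⟩ := h
  rw [gramDet_dist_eq_sq]
  refine sq_pos_of_ne_zero fun h0 => hline ?_
  have hp := p.im_pos
  have hq := q.im_pos
  have hs := s.im_pos
  rw [div_eq_zero_iff, or_iff_left (by positivity)] at h0
  by_cases hpq : p.re = q.re
  · by_cases hps : p.re = s.re
    · exact ⟨_, Or.inl ⟨p.re, rfl⟩, rfl, hpq.symm, hps.symm⟩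
    · obtain ⟨L, hL, h1, h2, h3⟩ := exists_hyperbolicLine (q := s) (s := q) hps
        (by linear_combination -h0)
      exact ⟨L, hL, h1, h3, h2⟩
  · exact exists_hyperbolicLine hpq h0

/-! ### Monotonicity of the angles of a single triangle -/

/-- The pairing of the angles of a Euclidean triangle of circles with a vector. -/
noncomputable def euclideanPairing (a b c u v w x y z : ℝ) : ℝ :=
  u * euclideanAngle √(sqLength c x y) √(sqLength b x z) √(sqLength a y z) +
  v * euclideanAngle √(sqLength c x y) √(sqLength a y z) √(sqLength b x z) +
  w * euclideanAngle √(sqLength b x z) √(sqLength a y z) √(sqLength c x y)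

lemma hasDerivAt_sqLength {c : ℝ} {X Y : ℝ → ℝ} {u v t : ℝ} (hX : HasDerivAt X (u * X t) t)
    (hY : HasDerivAt Y (v * Y t) t) :
    HasDerivAt (fun t => sqLength c (X t) (Y t)) (sqLengthDeriv c (X t) (Y t) u v) t := by
  have h := ((hX.pow 2).add (hY.pow 2)).add (((hX.const_mul 2).mul hY).mul_const c)
  refine h.congr_deriv ?_
  unfold sqLengthDeriv
  push_cast
  ring

/-- The angles of a Euclidean triangle of circles are monotone in the logarithms of the radii. -/
lemma euclideanPairing_lt {a b c : ℝ} (ha : -1 < a) (hb : -1 < b) (hc : -1 < c)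
    (h1 : 0 ≤ a + b * c) (h2 : 0 ≤ b + a * c) (h3 : 0 ≤ c + a * b) {u v w : ℝ}
    {x y z : ℝ} (hx : 0 < x) (hy : 0 < y) (hz : 0 < z)
    (hH : 0 < heron (sqLength c x y) (sqLength b x z) (sqLength a y z))
    (hne : ¬ (u = w ∧ v = w)) :
    euclideanPairing a b c u v w (x * Real.exp u) (y * Real.exp v) (z * Real.exp w) <
      euclideanPairing a b c u v w x y z := by
  -- The straight segment in logarithmic radii, with velocity (u, v, w).
  set X : ℝ → ℝ := fun t => x * Real.exp (u * t)
  set Y : ℝ → ℝ := fun t => y * Real.exp (v * t)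
  set Z : ℝ → ℝ := fun t => z * Real.exp (w * t)
  have hexp : ∀ k s t : ℝ, HasDerivAt (fun t => k * Real.exp (s * t)) (s * (k * Real.exp (s * t)))
      t := by
    intro k s t
    have := (((hasDerivAt_id t).const_mul s).exp).const_mul k
    simp only [id, mul_one] at this
    exact this.congr_deriv (by ring)
  have hX0 : ∀ t, 0 < X t := fun t => by positivity
  have hY0 : ∀ t, 0 < Y t := fun t => by positivity
  have hZ0 : ∀ t, 0 < Z t := fun t => by positivity
  have l3 : ∀ t, 0 < sqLength c (X t) (Y t) := fun t => sqLength_pos hc (hX0 t) (hY0 t)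
  have l2 : ∀ t, 0 < sqLength b (X t) (Z t) := fun t => sqLength_pos hb (hX0 t) (hZ0 t)
  have l1 : ∀ t, 0 < sqLength a (Y t) (Z t) := fun t => sqLength_pos ha (hY0 t) (hZ0 t)
  have d3 := fun t => hasDerivAt_sqLength (c := c) (hexp x u t) (hexp y v t)
  have d2 := fun t => hasDerivAt_sqLength (c := b) (hexp x u t) (hexp z w t)
  have d1 := fun t => hasDerivAt_sqLength (c := a) (hexp y v t) (hexp z w t)
  have hderiv : ∀ t, 0 < heron (sqLength c (X t) (Y t)) (sqLength b (X t) (Z t))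
      (sqLength a (Y t) (Z t)) →
      ∃ d < 0, HasDerivAt (fun t => euclideanPairing a b c u v w (X t) (Y t) (Z t)) d t := by
    intro t hpos
    have e2 : heron (sqLength c (X t) (Y t)) (sqLength a (Y t) (Z t)) (sqLength b (X t) (Z t)) =
        heron (sqLength c (X t) (Y t)) (sqLength b (X t) (Z t)) (sqLength a (Y t) (Z t)) := by
      unfold heron; ring
    have e3 : heron (sqLength b (X t) (Z t)) (sqLength a (Y t) (Z t)) (sqLength c (X t) (Y t)) =
        heron (sqLength c (X t) (Y t)) (sqLength b (X t) (Z t)) (sqLength a (Y t) (Z t)) := by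
      unfold heron; ring
    have k1 := (hasDerivAt_euclideanAngle (d3 t) (d2 t) (d1 t) (l3 t) (l2 t) (l1 t)
      hpos).const_mul u
    have k2 := (hasDerivAt_euclideanAngle (d3 t) (d1 t) (d2 t) (l3 t) (l1 t) (l2 t)
      (e2.symm ▸ hpos)).const_mul v
    have k3 := (hasDerivAt_euclideanAngle (d2 t) (d1 t) (d3 t) (l2 t) (l1 t) (l3 t)
      (e3.symm ▸ hpos)).const_mul w
    refine ⟨_, ?_, (k1.add k2).add k3⟩
    have hneg := sum_angleDeriv_neg ha hb hc (hX0 t) (hY0 t) (hZ0 t) h1 h2 h3 hpos hne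
    change u * (angleDeriv (sqLength c (X t) (Y t)) (sqLength b (X t) (Z t))
      (sqLength a (Y t) (Z t)) _ _ _ / √(heron (sqLength c (X t) (Y t)) (sqLength b (X t) (Z t))
      (sqLength a (Y t) (Z t)))) +
      v * (angleDeriv (sqLength c (X t) (Y t)) (sqLength a (Y t) (Z t))
      (sqLength b (X t) (Z t)) _ _ _ / √(heron (sqLength c (X t) (Y t)) (sqLength a (Y t) (Z t))
      (sqLength b (X t) (Z t)))) +
      w * (angleDeriv (sqLength b (X t) (Z t)) (sqLength a (Y t) (Z t))
      (sqLength c (X t) (Y t)) _ _ _ / √(heron (sqLength b (X t) (Z t)) (sqLength a (Y t) (Z t))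
      (sqLength c (X t) (Y t)))) < 0
    rw [e2, e3, ← mul_div_assoc, ← mul_div_assoc, ← mul_div_assoc, ← add_div, ← add_div]
    exact div_neg_of_neg_of_pos hneg (Real.sqrt_pos.2 hpos)
  have h01 := lt_of_deriv_neg_off_finite (g := fun t => euclideanPairing a b c u v w (X t) (Y t)
    (Z t)) (Φ := {u * Real.pi, v * Real.pi, w * Real.pi}) (by simp) zero_lt_one ?_ ?_ ?_
  · simpa [X, Y, Z] using h01
  · intro t _
    refine ContinuousAt.continuousWithinAt ?_
    unfold euclideanPairing
    exact (((continuousAt_euclideanAngle (d3 t).continuousAt (d2 t).continuousAt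
      (d1 t).continuousAt (l3 t) (l2 t)).const_mul u).add
      ((continuousAt_euclideanAngle (d3 t).continuousAt (d1 t).continuousAt
      (d2 t).continuousAt (l3 t) (l1 t)).const_mul v)).add
      ((continuousAt_euclideanAngle (d2 t).continuousAt (d1 t).continuousAt
      (d3 t).continuousAt (l2 t) (l1 t)).const_mul w)
  · intro t _
    by_cases hpos : 0 < heron (sqLength c (X t) (Y t)) (sqLength b (X t) (Z t))
      (sqLength a (Y t) (Z t))
    · exact Or.inr (hderiv t hpos)
    · refine Or.inl (euclideanAngle_pairing_degenerate (Real.sqrt_pos.2 (l3 t))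
        (Real.sqrt_pos.2 (l2 t)) (Real.sqrt_pos.2 (l1 t)) ?_ u v w)
      rw [Real.sq_sqrt (l3 t).le, Real.sq_sqrt (l2 t).le, Real.sq_sqrt (l1 t).le]
      exact not_lt.1 hpos
  · refine hderiv 0 ?_
    simpa [X, Y, Z] using hH

/-- The hyperbolic cosine of the side joining two circles, in terms of the numbers `X`, `Y` whose
hyperbolic sines are the inverses of those of the radii. -/
noncomputable def coshSide (c X Y : ℝ) : ℝ :=
  coshLength c (Real.cosh X) (Real.cosh Y) (Real.sinh X) (Real.sinh Y)

/-- The pairing of the angles of a hyperbolic triangle of circles with a vector. -/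
noncomputable def hyperbolicPairing (a b c u v w X Y Z : ℝ) : ℝ :=
  u * hyperbolicAngle (Real.arcosh (coshSide c X Y)) (Real.arcosh (coshSide b X Z))
    (Real.arcosh (coshSide a Y Z)) +
  v * hyperbolicAngle (Real.arcosh (coshSide c X Y)) (Real.arcosh (coshSide a Y Z))
    (Real.arcosh (coshSide b X Z)) +
  w * hyperbolicAngle (Real.arcosh (coshSide b X Z)) (Real.arcosh (coshSide a Y Z))
    (Real.arcosh (coshSide c X Y))

lemma one_lt_coshSide {c X Y : ℝ} (hc : -1 < c) (hX : 0 < X) (hY : 0 < Y) : 1 < coshSide c X Y :=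
  one_lt_coshLength hc (Real.cosh_pos X) (Real.cosh_pos Y) (Real.sinh_pos_iff.2 hX)
    (Real.sinh_pos_iff.2 hY) (Real.sinh_sq X) (Real.sinh_sq Y)

/-- X stands for -log tanh(r / 2), whence the minus signs: u and v are the velocities of log tanh(r
/ 2) at the two circles. -/
lemma hasDerivAt_coshSide {c : ℝ} {X Y : ℝ → ℝ} {u v t : ℝ} (hX : HasDerivAt X (-u) t)
    (hY : HasDerivAt Y (-v) t) (hX0 : 0 < X t) (hY0 : 0 < Y t) :
    HasDerivAt (fun t => coshSide c (X t) (Y t))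
      (coshLengthDeriv c (Real.cosh (X t)) (Real.cosh (Y t)) (Real.sinh (X t)) (Real.sinh (Y t))
        u v) t := by
  have sX := (Real.sinh_pos_iff.2 hX0).ne'
  have sY := (Real.sinh_pos_iff.2 hY0).ne'
  have h := ((hX.cosh.mul hY.cosh).add_const c).div (hX.sinh.mul hY.sinh) (mul_ne_zero sX sY)
  refine h.congr_deriv ?_
  have eX := Real.sinh_sq (X t)
  have eY := Real.sinh_sq (Y t)
  unfold coshLengthDeriv
  simp only [Pi.mul_apply]
  field_simp
  linear_combination
    (-(u * Real.cosh (Y t) * Real.sinh (Y t))) * eX +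
    (-(v * Real.cosh (X t) * Real.sinh (X t))) * eY

/-- The angles of a hyperbolic triangle of circles are monotone in the parameters. -/
lemma hyperbolicPairing_lt {a b c : ℝ} (ha : -1 < a) (hb : -1 < b) (hc : -1 < c)
    (h1 : 0 ≤ a + b * c) (h2 : 0 ≤ b + a * c) (h3 : 0 ≤ c + a * b)
    {x y z x' y' z' : ℝ} (hx : 0 < x) (hy : 0 < y) (hz : 0 < z)
    (hx' : 0 < x') (hy' : 0 < y') (hz' : 0 < z')
    (hH : 0 < gramDet (coshSide c x y) (coshSide b x z) (coshSide a y z))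
    (hne : ¬ (x - x' = 0 ∧ y - y' = 0 ∧ z - z' = 0)) :
    hyperbolicPairing a b c (x - x') (y - y') (z - z') x' y' z' <
      hyperbolicPairing a b c (x - x') (y - y') (z - z') x y z := by
  set X : ℝ → ℝ := fun t => x - (x - x') * t
  set Y : ℝ → ℝ := fun t => y - (y - y') * t
  set Z : ℝ → ℝ := fun t => z - (z - z') * t
  have hlin : ∀ k s t : ℝ, HasDerivAt (fun t => k - s * t) (-s) t := by
    intro k s t
    simpa using ((hasDerivAt_id t).const_mul s).const_sub k
  have hpos : ∀ k k' : ℝ, 0 < k → 0 < k' → ∀ t ∈ Set.Icc (0 : ℝ) 1, 0 < k - (k - k') * t := by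
    intro k k' hk hk' t ht
    have e : k - (k - k') * t = k * (1 - t) + k' * t := by ring
    rw [e]
    rcases ht.1.lt_or_eq with h | h
    · have : 0 ≤ k * (1 - t) := mul_nonneg hk.le (by linarith [ht.2])
      have : 0 < k' * t := by positivity
      linarith
    · rw [← h]; simpa using hk
  have hX0 : ∀ t ∈ Set.Icc (0 : ℝ) 1, 0 < X t := hpos x x' hx hx'
  have hY0 : ∀ t ∈ Set.Icc (0 : ℝ) 1, 0 < Y t := hpos y y' hy hy'
  have hZ0 : ∀ t ∈ Set.Icc (0 : ℝ) 1, 0 < Z t := hpos z z' hz hz'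
  have l3 : ∀ t ∈ Set.Icc (0 : ℝ) 1, 1 < coshSide c (X t) (Y t) :=
    fun t ht => one_lt_coshSide hc (hX0 t ht) (hY0 t ht)
  have l2 : ∀ t ∈ Set.Icc (0 : ℝ) 1, 1 < coshSide b (X t) (Z t) :=
    fun t ht => one_lt_coshSide hb (hX0 t ht) (hZ0 t ht)
  have l1 : ∀ t ∈ Set.Icc (0 : ℝ) 1, 1 < coshSide a (Y t) (Z t) :=
    fun t ht => one_lt_coshSide ha (hY0 t ht) (hZ0 t ht)
  have d3 := fun t ht => hasDerivAt_coshSide (c := c) (hlin x (x - x') t) (hlin y (y - y') t)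
    (hX0 t ht) (hY0 t ht)
  have d2 := fun t ht => hasDerivAt_coshSide (c := b) (hlin x (x - x') t) (hlin z (z - z') t)
    (hX0 t ht) (hZ0 t ht)
  have d1 := fun t ht => hasDerivAt_coshSide (c := a) (hlin y (y - y') t) (hlin z (z - z') t)
    (hY0 t ht) (hZ0 t ht)
  have hderiv : ∀ t ∈ Set.Icc (0 : ℝ) 1, 0 < gramDet (coshSide c (X t) (Y t))
      (coshSide b (X t) (Z t)) (coshSide a (Y t) (Z t)) →
      ∃ d < 0, HasDerivAt (fun t => hyperbolicPairing a b c (x - x') (y - y') (z - z')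
        (X t) (Y t) (Z t)) d t := by
    intro t ht hpos
    have e2 : gramDet (coshSide c (X t) (Y t)) (coshSide a (Y t) (Z t)) (coshSide b (X t) (Z t)) =
        gramDet (coshSide c (X t) (Y t)) (coshSide b (X t) (Z t)) (coshSide a (Y t) (Z t)) := by
      unfold gramDet; ring
    have e3 : gramDet (coshSide b (X t) (Z t)) (coshSide a (Y t) (Z t)) (coshSide c (X t) (Y t)) =
        gramDet (coshSide c (X t) (Y t)) (coshSide b (X t) (Z t)) (coshSide a (Y t) (Z t)) := by
      unfold gramDet; ring
    have k1 := (hasDerivAt_hyperbolicAngle (d3 t ht) (d2 t ht) (d1 t ht) (l3 t ht) (l2 t ht)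
      (l1 t ht) hpos).const_mul (x - x')
    have k2 := (hasDerivAt_hyperbolicAngle (d3 t ht) (d1 t ht) (d2 t ht) (l3 t ht) (l1 t ht)
      (l2 t ht) (e2.symm ▸ hpos)).const_mul (y - y')
    have k3 := (hasDerivAt_hyperbolicAngle (d2 t ht) (d1 t ht) (d3 t ht) (l2 t ht) (l1 t ht)
      (l3 t ht) (e3.symm ▸ hpos)).const_mul (z - z')
    refine ⟨_, ?_, (k1.add k2).add k3⟩
    have hneg := sum_hypAngleDeriv_neg ha hb hc (Real.cosh_pos (X t)) (Real.cosh_pos (Y t))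
      (Real.cosh_pos (Z t)) (Real.sinh_pos_iff.2 (hX0 t ht)) (Real.sinh_pos_iff.2 (hY0 t ht))
      (Real.sinh_pos_iff.2 (hZ0 t ht)) (Real.sinh_sq _) (Real.sinh_sq _) (Real.sinh_sq _)
      h1 h2 h3 hpos hne
    change (x - x') * (hypAngleDeriv (coshSide c (X t) (Y t)) (coshSide b (X t) (Z t))
      (coshSide a (Y t) (Z t)) _ _ _ / √(gramDet (coshSide c (X t) (Y t)) (coshSide b (X t) (Z t))
      (coshSide a (Y t) (Z t)))) +
      (y - y') * (hypAngleDeriv (coshSide c (X t) (Y t)) (coshSide a (Y t) (Z t))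
      (coshSide b (X t) (Z t)) _ _ _ / √(gramDet (coshSide c (X t) (Y t)) (coshSide a (Y t) (Z t))
      (coshSide b (X t) (Z t)))) +
      (z - z') * (hypAngleDeriv (coshSide b (X t) (Z t)) (coshSide a (Y t) (Z t))
      (coshSide c (X t) (Y t)) _ _ _ / √(gramDet (coshSide b (X t) (Z t)) (coshSide a (Y t) (Z t))
      (coshSide c (X t) (Y t)))) < 0
    rw [e2, e3, ← mul_div_assoc, ← mul_div_assoc, ← mul_div_assoc, ← add_div, ← add_div]
    exact div_neg_of_neg_of_pos hneg (Real.sqrt_pos.2 hpos)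
  have h01 := lt_of_deriv_neg_off_finite (g := fun t => hyperbolicPairing a b c (x - x') (y - y')
    (z - z') (X t) (Y t) (Z t)) (Φ := {(x - x') * Real.pi, (y - y') * Real.pi,
    (z - z') * Real.pi}) (by simp) zero_lt_one ?_ ?_ ?_
  · simpa [X, Y, Z] using h01
  · intro t ht
    refine ContinuousAt.continuousWithinAt ?_
    unfold hyperbolicPairing
    exact (((continuousAt_hyperbolicAngle (d3 t ht).continuousAt (d2 t ht).continuousAt
      (d1 t ht).continuousAt (l3 t ht) (l2 t ht) (l1 t ht)).const_mul (x - x')).add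
      ((continuousAt_hyperbolicAngle (d3 t ht).continuousAt (d1 t ht).continuousAt
      (d2 t ht).continuousAt (l3 t ht) (l1 t ht) (l2 t ht)).const_mul (y - y'))).add
      ((continuousAt_hyperbolicAngle (d2 t ht).continuousAt (d1 t ht).continuousAt
      (d3 t ht).continuousAt (l2 t ht) (l1 t ht) (l3 t ht)).const_mul (z - z'))
  · intro t ht
    by_cases hpos : 0 < gramDet (coshSide c (X t) (Y t)) (coshSide b (X t) (Z t))
      (coshSide a (Y t) (Z t))
    · exact Or.inr (hderiv t ht hpos)
    · refine Or.inl (hyperbolicAngle_pairing_degenerate (Real.arcosh_pos (l3 t ht))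
        (Real.arcosh_pos (l2 t ht)) (Real.arcosh_pos (l1 t ht)) ?_ _ _ _)
      rw [Real.cosh_arcosh (l3 t ht).le, Real.cosh_arcosh (l2 t ht).le,
        Real.cosh_arcosh (l1 t ht).le]
      exact not_lt.1 hpos
  · refine hderiv 0 (by simp) ?_
    simpa [X, Y, Z] using hH

/-! ### Combinatorics of triangulations -/

namespace Triangulation

variable {V : Type*} [Fintype V] [DecidableEq V] {M : Type*} [TopologicalSpace M]

lemma IsFace.rotate {T : Triangulation V M} {i j k : V} (h : T.IsFace i j k) : T.IsFace j k i := by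
  obtain ⟨hij, hik, hjk, hm⟩ := h
  refine ⟨hjk, hij.symm, hik.symm, ?_⟩
  convert hm using 1
  ext; simp; tauto

lemma isFace_rotate_iff {T : Triangulation V M} {i j k : V} : T.IsFace j k i ↔ T.IsFace i j k :=
  ⟨fun h => h.rotate.rotate, fun h => h.rotate⟩

lemma IsFace.isEdge {T : Triangulation V M} {i j k : V} (h : T.IsFace i j k) : T.IsEdge i j := by
  obtain ⟨hij, -, -, hm⟩ := h
  refine ⟨hij, (T.complex.isRelLowerSet_faces hm).2 ?_ (by simp)⟩
  intro x
  simp only [Finset.mem_insert, Finset.mem_singleton]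
  tauto

lemma exists_isFace_of_subset {T : Triangulation V M} {t : Finset V} (ht : t ∈ T.complex)
    (hcard : t.card = 3) {i j : V} (hi : i ∈ t) (hj : j ∈ t) (hij : i ≠ j) :
    ∃ k, T.IsFace i j k := by
  obtain ⟨k, hk, hkij⟩ := Finset.exists_mem_notMem_of_card_lt_card
    (show ({i, j} : Finset V).card < t.card by rw [Finset.card_pair hij]; omega)
  simp only [Finset.mem_insert, Finset.mem_singleton, not_or] at hkij
  have hik : i ≠ k := Ne.symm hkij.1
  have hjk : j ≠ k := Ne.symm hkij.2
  refine ⟨k, hij, hik, hjk, ?_⟩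
  have hsub : ({i, j, k} : Finset V) ⊆ t := by
    simp [Finset.insert_subset_iff, hi, hj, hk]
  rwa [Finset.eq_of_subset_of_card_le hsub (by rw [Finset.card_eq_three.2
    ⟨i, j, k, hij, hik, hjk, rfl⟩, hcard])]

lemma exists_isFace (T : Triangulation V M) (i : V) : ∃ j k, T.IsFace i j k := by
  obtain ⟨t, ht, hit, hcard⟩ := T.pure {i} (T.complex.singleton_mem i)
  have hi : i ∈ t := hit (Finset.mem_singleton_self i)
  obtain ⟨j, hj, hji⟩ := Finset.exists_mem_ne (by omega : 1 < t.card) i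
  exact ⟨j, exists_isFace_of_subset ht hcard hi hj hji.symm⟩

/-- On a connected surface a function that is constant along edges is constant. -/
lemma eq_of_forall_isFace [ConnectedSpace M] (T : Triangulation V M) {f : V → ℝ}
    (hf : ∀ i j k, T.IsFace i j k → f i = f j) (i j : V) : f i = f j := by
  have hconn : ConnectedSpace (realization T.complex) :=
    T.homeo.symm.surjective.connectedSpace T.homeo.symm.continuous
  have hsimplex : ∀ s ∈ T.complex, ∀ v ∈ s, ∀ w ∈ s, f v = f w := by
    intro s hs v hv w hw
    by_cases hvw : v = w
    · rw [hvw]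
    · obtain ⟨t, ht, hst, hcard⟩ := T.pure s hs
      obtain ⟨k, hk⟩ := exists_isFace_of_subset ht hcard (hst hv) (hst hw) hvw
      exact hf v w k hk
  -- The piecewise linear extension of f. On each simplex it equals a single value of f, so it is a
  -- continuous function with finite range on a connected space.
  let Φ : realization T.complex → ℝ := fun x => ∑ v, x.1 v * f v
  have hΦ : Continuous Φ := continuous_finsetSum _ fun v _ =>
    ((continuous_apply v).comp continuous_subtype_val).mul_const _
  have hfin : (Set.range Φ).Finite := by
    refine (Set.finite_range f).subset ?_
    rintro _ ⟨⟨x, hx, s, hs, hxs⟩, rfl⟩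
    obtain ⟨v, hv⟩ := (T.complex.isRelLowerSet_faces hs).1
    refine ⟨v, ?_⟩
    have : ∀ w, x w * f w = x w * f v := by
      intro w
      by_cases hw : x w = 0
      · simp [hw]
      · rw [hsimplex s hs w (hxs w hw) v hv]
    simp only [Φ, this, ← Finset.sum_mul, hx.2, one_mul]
  have hsub : (Set.range Φ).Subsingleton := by
    by_contra h
    exact (isPreconnected_range hΦ).infinite_of_nontrivial (Set.not_subsingleton_iff.1 h) hfin
  have hmem : ∀ v : V, Pi.single v (1 : ℝ) ∈ realization T.complex := by
    intro v
    refine ⟨single_mem_stdSimplex ℝ v, {v}, T.complex.singleton_mem v, fun w hw => ?_⟩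
    by_contra h
    rw [Finset.mem_singleton] at h
    exact hw (Pi.single_eq_of_ne h 1)
  have hval : ∀ v : V, Φ ⟨Pi.single v 1, hmem v⟩ = f v := by
    intro v
    simp [Φ, Pi.single_apply]
  rw [← hval i, ← hval j]
  exact hsub ⟨_, rfl⟩ ⟨_, rfl⟩

/-- The pairing of the angles at the vertices of a triple with a function on the vertices. -/
def anglePairing (v : V → ℝ) (θ : V → V → V → ℝ) (i j k : V) : ℝ :=
  v i * θ i j k + v j * θ j k i + v k * θ k i j

-- The factor 6 counts the orderings of a face: 2 undoes the division in `coneAngle`, and 3 comes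
-- from the cyclic rotations that collect the three angles of a face.
open Classical in
lemma sum_mul_coneAngle (T : Triangulation V M) (v : V → ℝ) (θ : V → V → V → ℝ) :
    6 * ∑ i, v i * T.coneAngle θ i =
      ∑ i, ∑ j, ∑ k, if T.IsFace i j k then anglePairing v θ i j k else 0 := by
  set g : V → V → V → ℝ := fun i j k => if T.IsFace i j k then v i * θ i j k else 0 with hg
  have h1 : 2 * ∑ i, v i * T.coneAngle θ i = ∑ i, ∑ j, ∑ k, g i j k := by
    rw [Finset.mul_sum]
    refine Finset.sum_congr rfl fun i _ => ?_
    rw [coneAngle, hg]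
    simp only [← mul_ite_zero, ← Finset.mul_sum]
    ring
  have h2 : ∀ i j k, (if T.IsFace i j k then anglePairing v θ i j k else 0) =
      g i j k + g j k i + g k i j := by
    intro i j k
    simp only [hg, isFace_rotate_iff (i := i) (j := j) (k := k),
      ← isFace_rotate_iff (i := k) (j := i) (k := j), anglePairing]
    split_ifs <;> simp
  have h3 : ∑ i, ∑ j, ∑ k, g j k i = ∑ i, ∑ j, ∑ k, g i j k := by
    rw [Finset.sum_comm]
    refine Finset.sum_congr rfl fun j _ => Finset.sum_comm
  have h4 : ∑ i, ∑ j, ∑ k, g k i j = ∑ i, ∑ j, ∑ k, g i j k := by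
    rw [← h3]
    have : ∑ i, ∑ j, ∑ k, g k i j = ∑ i, ∑ k, ∑ j, g k i j :=
      Finset.sum_congr rfl fun i _ => Finset.sum_comm
    rw [this, Finset.sum_comm, h3]
  simp only [h2, Finset.sum_add_distrib, h3, h4]
  linarith

/-- If two systems of angles have the same cone angles, and on every face the pairing with `v` of
one is at most that of the other, then the pairings agree. -/
lemma anglePairing_eq {T : Triangulation V M} {v : V → ℝ} {θ θ' : V → V → V → ℝ}
    (h : ∀ i, T.coneAngle θ i = T.coneAngle θ' i)
    (hle : ∀ i j k, T.IsFace i j k → anglePairing v θ' i j k ≤ anglePairing v θ i j k)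
    {i j k : V} (hijk : T.IsFace i j k) : anglePairing v θ' i j k = anglePairing v θ i j k := by
  classical
  have hs := (T.sum_mul_coneAngle v θ).symm.trans (by simp only [h]) |>.trans
    (T.sum_mul_coneAngle v θ')
  have hle' : ∀ i j k, (if T.IsFace i j k then anglePairing v θ' i j k else 0) ≤
      if T.IsFace i j k then anglePairing v θ i j k else 0 := by
    intro i j k
    split_ifs with hf
    · exact hle i j k hf
    · exact le_rfl
  have e1 := (Finset.sum_eq_sum_iff_of_le fun i _ => Finset.sum_le_sum fun j _ =>
    Finset.sum_le_sum fun k _ => hle' i j k).1 hs.symm i (Finset.mem_univ i)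
  have e2 := (Finset.sum_eq_sum_iff_of_le fun j _ =>
    Finset.sum_le_sum fun k _ => hle' i j k).1 e1 j (Finset.mem_univ j)
  have e3 := (Finset.sum_eq_sum_iff_of_le fun k _ => hle' i j k).1 e2 k (Finset.mem_univ k)
  rwa [if_pos hijk, if_pos hijk] at e3

end Triangulation

/-! ### From a single triangle to the whole surface -/

section Rigidity

variable {V : Type*}

lemma euclideanLength_comm (I : Sym2 V → ℝ) (r : V → ℝ) (i j : V) :
    euclideanLength I r i j = euclideanLength I r j i := by
  unfold euclideanLength; rw [Sym2.eq_swap]; congr 1; ring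

lemma hyperbolicLength_comm (I : Sym2 V → ℝ) (r : V → ℝ) (i j : V) :
    hyperbolicLength I r i j = hyperbolicLength I r j i := by
  unfold hyperbolicLength; rw [Sym2.eq_swap]; congr 1; ring

lemma euclideanLength_smul {c : ℝ} (hc : 0 < c) (I : Sym2 V → ℝ) {r r' : V → ℝ} {i j : V}
    (hi : r' i = c * r i) (hj : r' j = c * r j) :
    euclideanLength I r' i j = c * euclideanLength I r i j := by
  rw [euclideanLength, euclideanLength, hi, hj, ← Real.sqrt_sq hc.le,
    ← Real.sqrt_mul (sq_nonneg c), Real.sqrt_sq hc.le]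
  congr 1; ring

lemma euclideanAngle_smul {k : ℝ} (hk : 0 < k) (a b c : ℝ) :
    euclideanAngle (k * a) (k * b) (k * c) = euclideanAngle a b c := by
  unfold euclideanAngle
  congr 1
  rw [show (k * a) ^ 2 + (k * b) ^ 2 - (k * c) ^ 2 = k ^ 2 * (a ^ 2 + b ^ 2 - c ^ 2) by ring,
    show 2 * (k * a) * (k * b) = k ^ 2 * (2 * a * b) by ring]
  exact mul_div_mul_left _ _ (by positivity)

/-- The angle at `i` in the triangle `i`, `j`, `k` of Euclidean circles. -/
noncomputable def euclideanInner (I : Sym2 V → ℝ) (r : V → ℝ) (i j k : V) : ℝ :=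
  euclideanAngle (euclideanLength I r i j) (euclideanLength I r i k) (euclideanLength I r j k)

/-- The angle at `i` in the triangle `i`, `j`, `k` of hyperbolic circles. -/
noncomputable def hyperbolicInner (I : Sym2 V → ℝ) (r : V → ℝ) (i j k : V) : ℝ :=
  hyperbolicAngle (hyperbolicLength I r i j) (hyperbolicLength I r i k) (hyperbolicLength I r j k)

lemma euclideanInner_smul {c : ℝ} (hc : 0 < c) (I : Sym2 V → ℝ) {r r' : V → ℝ} {i j k : V}
    (hi : r' i = c * r i) (hj : r' j = c * r j) (hk : r' k = c * r k) :
    euclideanInner I r' i j k = euclideanInner I r i j k := by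
  unfold euclideanInner
  rw [euclideanLength_smul hc I hi hj, euclideanLength_smul hc I hi hk,
    euclideanLength_smul hc I hj hk, euclideanAngle_smul hc]

lemma anglePairing_euclideanInner (I : Sym2 V → ℝ) (v r : V → ℝ) (i j k : V) :
    Triangulation.anglePairing v (euclideanInner I r) i j k =
      euclideanPairing (I s(j, k)) (I s(i, k)) (I s(i, j)) (v i) (v j) (v k) (r i) (r j) (r k) := by
  unfold Triangulation.anglePairing euclideanInner
  rw [euclideanLength_comm I r k i, euclideanLength_comm I r k j, euclideanLength_comm I r j i,
    euclideanAngle_comm (euclideanLength I r i j) (euclideanLength I r j k)]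
  rfl

/-- The parameter whose hyperbolic sine is the inverse of that of the radius. -/
noncomputable def dualRadius (r : ℝ) : ℝ := Real.arsinh (Real.sinh r)⁻¹

lemma dualRadius_pos {r : ℝ} (hr : 0 < r) : 0 < dualRadius r :=
  Real.arsinh_pos_iff.2 (inv_pos.2 (Real.sinh_pos_iff.2 hr))

lemma dualRadius_injective : Function.Injective dualRadius := fun _ _ h =>
  Real.sinh_injective (inv_injective (Real.arsinh_injective h))

lemma cosh_dualRadius {r : ℝ} (hr : 0 < r) :
    Real.cosh (dualRadius r) = Real.cosh r / Real.sinh r := by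
  have hs := Real.sinh_pos_iff.2 hr
  rw [dualRadius, Real.cosh_arsinh]
  have e : 1 + (Real.sinh r)⁻¹ ^ 2 = (Real.cosh r / Real.sinh r) ^ 2 := by
    have := Real.sinh_sq r
    field_simp
    linarith
  rw [e, Real.sqrt_sq (div_nonneg (Real.cosh_pos r).le hs.le)]

lemma coshSide_dualRadius (c : ℝ) {r s : ℝ} (hr : 0 < r) (hs : 0 < s) :
    coshSide c (dualRadius r) (dualRadius s) =
      Real.cosh r * Real.cosh s + c * Real.sinh r * Real.sinh s := by
  have h1 := Real.sinh_pos_iff.2 hr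
  have h2 := Real.sinh_pos_iff.2 hs
  rw [coshSide, coshLength, cosh_dualRadius hr, cosh_dualRadius hs, dualRadius, dualRadius,
    Real.sinh_arsinh, Real.sinh_arsinh]
  field_simp

lemma hyperbolicLength_eq (I : Sym2 V → ℝ) {r : V → ℝ} (hr : ∀ i, 0 < r i) (i j : V) :
    hyperbolicLength I r i j =
      Real.arcosh (coshSide (I s(i, j)) (dualRadius (r i)) (dualRadius (r j))) := by
  rw [coshSide_dualRadius _ (hr i) (hr j), hyperbolicLength]

lemma anglePairing_hyperbolicInner (I : Sym2 V → ℝ) (v : V → ℝ) {r : V → ℝ} (hr : ∀ i, 0 < r i)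
    (i j k : V) :
    Triangulation.anglePairing v (hyperbolicInner I r) i j k =
      hyperbolicPairing (I s(j, k)) (I s(i, k)) (I s(i, j)) (v i) (v j) (v k)
        (dualRadius (r i)) (dualRadius (r j)) (dualRadius (r k)) := by
  unfold Triangulation.anglePairing hyperbolicInner hyperbolicPairing
  rw [hyperbolicLength_comm I r k i, hyperbolicLength_comm I r k j, hyperbolicLength_comm I r j i,
    hyperbolicAngle_comm (hyperbolicLength I r i j) (hyperbolicLength I r j k)]
  simp only [hyperbolicLength_eq I hr]

variable [Fintype V] [DecidableEq V] {M : Type*} [TopologicalSpace M]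

lemma structure_conditions {T : Triangulation V M} {I : Sym2 V → ℝ}
    (hI : ∀ i j, T.IsEdge i j → -1 < I s(i, j))
    (hstruct : ∀ i j k, T.IsFace i j k → 0 ≤ I s(i, j) + I s(i, k) * I s(j, k))
    {i j k : V} (h : T.IsFace i j k) :
    -1 < I s(j, k) ∧ -1 < I s(i, k) ∧ -1 < I s(i, j) ∧
      0 ≤ I s(j, k) + I s(i, k) * I s(i, j) ∧ 0 ≤ I s(i, k) + I s(j, k) * I s(i, j) ∧
      0 ≤ I s(i, j) + I s(j, k) * I s(i, k) := by
  have h1 := hstruct i j k h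
  have h2 := hstruct j k i h.rotate
  have h3 := hstruct k i j h.rotate.rotate
  have e1 := hI _ _ h.isEdge
  have e2 := hI _ _ h.rotate.isEdge
  have e3 := hI _ _ h.rotate.rotate.isEdge
  rw [Sym2.eq_swap (a := j) (b := i), Sym2.eq_swap (a := k) (b := i)] at h2
  rw [Sym2.eq_swap (a := k) (b := i), Sym2.eq_swap (a := k) (b := j)] at h3
  rw [Sym2.eq_swap (a := k) (b := i)] at e3
  exact ⟨e2, e3, e1, by linarith, by linarith, by linarith⟩

/-- Rigidity in Euclidean background geometry. -/
lemma euclidean_rigidity [ConnectedSpace M] (T : Triangulation V M) (I : Sym2 V → ℝ)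
    (hI : ∀ i j, T.IsEdge i j → -1 < I s(i, j))
    (hstruct : ∀ i j k, T.IsFace i j k → 0 ≤ I s(i, j) + I s(i, k) * I s(j, k))
    {r r' : V → ℝ} (hr : IsEuclideanMetric T I r) (hr' : IsEuclideanMetric T I r')
    (hK : euclideanCurvature T I r = euclideanCurvature T I r') :
    ∃ c : ℝ, 0 < c ∧ ∀ i, r' i = c * r i := by
  set u : V → ℝ := fun i => Real.log (r' i / r i) with hu
  have hru : ∀ i, r' i = r i * Real.exp (u i) := by
    intro i
    have h1 := hr.pos i
    rw [hu, Real.exp_log (div_pos (hr'.pos i) h1)]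
    field_simp
  have hcone : ∀ i, T.coneAngle (euclideanInner I r) i = T.coneAngle (euclideanInner I r') i := by
    intro i
    have := congrFun hK i
    unfold euclideanCurvature at this
    exact sub_right_injective this
  have hlt : ∀ i j k, T.IsFace i j k → ¬ (u i = u k ∧ u j = u k) →
      Triangulation.anglePairing u (euclideanInner I r') i j k <
        Triangulation.anglePairing u (euclideanInner I r) i j k := by
    intro i j k hf hne
    obtain ⟨ha, hb, hc, h1, h2, h3⟩ := structure_conditions hI hstruct hf
    have hH := heron_pos_of_isEuclideanTriangle (hr.nondegenerate i j k hf)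
    have l3 := sqLength_pos hc (hr.pos i) (hr.pos j)
    have l2 := sqLength_pos hb (hr.pos i) (hr.pos k)
    have l1 := sqLength_pos ha (hr.pos j) (hr.pos k)
    have hH' : 0 < heron (√(sqLength (I s(i, j)) (r i) (r j)) ^ 2)
      (√(sqLength (I s(i, k)) (r i) (r k)) ^ 2) (√(sqLength (I s(j, k)) (r j) (r k)) ^ 2) := hH
    rw [Real.sq_sqrt l3.le, Real.sq_sqrt l2.le, Real.sq_sqrt l1.le] at hH'
    rw [anglePairing_euclideanInner, anglePairing_euclideanInner, hru i, hru j, hru k]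
    exact euclideanPairing_lt ha hb hc h1 h2 h3 (hr.pos i) (hr.pos j) (hr.pos k) hH' hne
  have hle : ∀ i j k, T.IsFace i j k →
      Triangulation.anglePairing u (euclideanInner I r') i j k ≤
        Triangulation.anglePairing u (euclideanInner I r) i j k := by
    intro i j k hf
    -- If u is constant on the face, the two triangles are similar and the pairings agree.
    by_cases hne : u i = u k ∧ u j = u k
    · have hi : r' i = Real.exp (u k) * r i := by rw [hru i, hne.1, mul_comm]
      have hj : r' j = Real.exp (u k) * r j := by rw [hru j, hne.2, mul_comm]
      have hk : r' k = Real.exp (u k) * r k := by rw [hru k, mul_comm]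
      have hpos := Real.exp_pos (u k)
      unfold Triangulation.anglePairing
      rw [euclideanInner_smul hpos I hi hj hk, euclideanInner_smul hpos I hj hk hi,
        euclideanInner_smul hpos I hk hi hj]
    · exact (hlt i j k hf hne).le
  have hface : ∀ i j k, T.IsFace i j k → u i = u j := by
    intro i j k hf
    by_contra hne
    exact (hlt i j k hf fun h => hne (h.1.trans h.2.symm)).ne
      (Triangulation.anglePairing_eq hcone hle hf)
  have hconst := T.eq_of_forall_isFace hface
  rcases isEmpty_or_nonempty V with hV | ⟨⟨o⟩⟩
  · exact ⟨1, one_pos, fun i => hV.elim i⟩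
  · exact ⟨Real.exp (u o), Real.exp_pos _, fun i => by rw [hru i, hconst i o, mul_comm]⟩

/-- Rigidity in hyperbolic background geometry. -/
lemma hyperbolic_rigidity (T : Triangulation V M) (I : Sym2 V → ℝ)
    (hI : ∀ i j, T.IsEdge i j → -1 < I s(i, j))
    (hstruct : ∀ i j k, T.IsFace i j k → 0 ≤ I s(i, j) + I s(i, k) * I s(j, k))
    {r r' : V → ℝ} (hr : IsHyperbolicMetric T I r) (hr' : IsHyperbolicMetric T I r')
    (hK : hyperbolicCurvature T I r = hyperbolicCurvature T I r') : r = r' := by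
  set u : V → ℝ := fun i => dualRadius (r i) - dualRadius (r' i) with hu
  have hcone : ∀ i, T.coneAngle (hyperbolicInner I r) i =
      T.coneAngle (hyperbolicInner I r') i := by
    intro i
    have := congrFun hK i
    unfold hyperbolicCurvature at this
    exact sub_right_injective this
  have hlt : ∀ i j k, T.IsFace i j k → ¬ (u i = 0 ∧ u j = 0 ∧ u k = 0) →
      Triangulation.anglePairing u (hyperbolicInner I r') i j k <
        Triangulation.anglePairing u (hyperbolicInner I r) i j k := by
    intro i j k hf hne
    obtain ⟨ha, hb, hc, h1, h2, h3⟩ := structure_conditions hI hstruct hf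
    have hi := dualRadius_pos (hr.pos i)
    have hj := dualRadius_pos (hr.pos j)
    have hk := dualRadius_pos (hr.pos k)
    have hH := gramDet_pos_of_isHyperbolicTriangle (hr.nondegenerate i j k hf)
    rw [hyperbolicLength_eq I hr.pos, hyperbolicLength_eq I hr.pos, hyperbolicLength_eq I hr.pos,
      Real.cosh_arcosh (one_lt_coshSide hc hi hj).le, Real.cosh_arcosh (one_lt_coshSide hb hi hk).le,
      Real.cosh_arcosh (one_lt_coshSide ha hj hk).le] at hH
    rw [anglePairing_hyperbolicInner I u hr.pos, anglePairing_hyperbolicInner I u hr'.pos]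
    exact hyperbolicPairing_lt ha hb hc h1 h2 h3 hi hj hk (dualRadius_pos (hr'.pos i))
      (dualRadius_pos (hr'.pos j)) (dualRadius_pos (hr'.pos k)) hH hne
  have hle : ∀ i j k, T.IsFace i j k →
      Triangulation.anglePairing u (hyperbolicInner I r') i j k ≤
        Triangulation.anglePairing u (hyperbolicInner I r) i j k := by
    intro i j k hf
    by_cases hne : u i = 0 ∧ u j = 0 ∧ u k = 0
    · unfold Triangulation.anglePairing
      simp [hne.1, hne.2.1, hne.2.2]
    · exact (hlt i j k hf hne).le
  funext i
  -- Here u vanishes on each face separately, and every vertex lies on a face, so no propagation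
  -- along the surface is needed.
  obtain ⟨j, k, hf⟩ := T.exists_isFace i
  have hi : u i = 0 := by
    by_contra hne
    exact (hlt i j k hf fun h => hne h.1).ne (Triangulation.anglePairing_eq hcone hle hf)
  exact dualRadius_injective (sub_eq_zero.1 hi)

end Rigidity

end CirclePacking

/-- Global rigidity of inversive distance circle packings on a compact connected surface
(possibly with boundary), in Euclidean and in hyperbolic background geometry. -/
theorem mainTheorem1 {V : Type*} [Fintype V] [DecidableEq V]
    {M : Type*} [TopologicalSpace M] [T2Space M] [CompactSpace M] [ConnectedSpace M]
    [ChartedSpace (EuclideanHalfSpace 2) M]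
    (T : CirclePacking.Triangulation V M) (I : Sym2 V → ℝ)
    (hI : ∀ i j, T.IsEdge i j → -1 < I s(i, j))
    (hstruct : ∀ i j k, T.IsFace i j k → 0 ≤ I s(i, j) + I s(i, k) * I s(j, k)) :
    (∀ r r' : V → ℝ, CirclePacking.IsEuclideanMetric T I r →
      CirclePacking.IsEuclideanMetric T I r' →
      (CirclePacking.euclideanCurvature T I r = CirclePacking.euclideanCurvature T I r' ↔
        ∃ c : ℝ, 0 < c ∧ ∀ i, r' i = c * r i)) ∧
    (∀ r r' : V → ℝ, CirclePacking.IsHyperbolicMetric T I r →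
      CirclePacking.IsHyperbolicMetric T I r' →
      CirclePacking.hyperbolicCurvature T I r = CirclePacking.hyperbolicCurvature T I r' →
      r = r') := by
  refine ⟨fun r r' hr hr' => ⟨CirclePacking.euclidean_rigidity T I hI hstruct hr hr', ?_⟩,
    fun r r' hr hr' => CirclePacking.hyperbolic_rigidity T I hI hstruct hr hr'⟩
  rintro ⟨c, hc, h⟩
  have e : CirclePacking.euclideanInner I r' = CirclePacking.euclideanInner I r := by
    funext i j k
    exact CirclePacking.euclideanInner_smul hc I (h i) (h j) (h k)
  funext i
  change 2 * Real.pi - T.coneAngle (CirclePacking.euclideanInner I r) i =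
    2 * Real.pi - T.coneAngle (CirclePacking.euclideanInner I r') i
  rw [e]
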